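/- All graphs are finite and simple. For $d\in\mathbb{N}$, the $d$th power $G^d$ of a graph $G$ has the same vertex set as $G$, two distinct vertices being adjacent if and only if their distance in $G$ is at most $d$; for a class $\mathcal{C}$ of graphs put $\mathcal{C}^d=\{G^d : G\in\mathcal{C}\}$. The hereditary closure of a class consists of all graphs isomorphic to an induced subgraph of a member of the class. A graph $H$ is a depth-$r$ minor of $G$ if it can be obtained from a subgraph of $G$ by contracting pairwise disjoint connected subgraphs of radius at most $r$. The class $\mathcal{C}$ is nowhere dense if for every $r\in\mathbb{N}$ the clique numbers of the depth-$r$ minors of graphs from $\mathcal{C}$ are bounded. $N_H[a]$ denotes the closed neighborhood of $a$ in $H$, and maximal cliques are inclusion-wise maximal. Theorem. Let $\mathcal{C}$ be a nowhere dense class of graphs and let $d\in\mathbb{N}$. Then there is $q\in\mathbb{N}$ such that every graph $H$ in the hereditary closure of $\mathcal{C}^d$, with $n$ vertices, satisfies the following. 1. If $n\ge 1$, then $H$ has at most $n^q$ maximal cliques. 2. For every maximal clique $K$ of $H$ there is a set $A\subseteq K$ with $|A|\le q$ and $K=\bigcap_{a\in A}N_H[a]$ (the empty intersection being $V(H)$).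 Moreover, there are a polynomial $p$ and an algorithm (a program of a random access machine with addition and truncated subtraction of natural numbers, each instruction and each test costing one step), depending only on $\mathcal{C}$ and $d$, which, given the adjacency matrix of a graph $H$ from the hereditary closure of $\mathcal{C}^d$, with its $n$ vertices numbered in any way, halts after at most $p(n)$ steps having listed all maximal cliques of $H$, each exactly once. -/

import Mathlib

universe u

/-! ### Finite graphs, graph classes, powers, hereditary closure -/

/-- A finite simple graph. A class of graphs is a set of such graphs. -/
structure FinGraph : Type (u + 1) where
  /-- the vertex set -/
  V : Type u
  /-- the vertex set is finite -/
  [finite : Finite V]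
  /-- the adjacency structure -/
  graph : SimpleGraph V

attribute [instance] FinGraph.finite

namespace FinGraph

/-- The number of vertices. -/
noncomputable def order (G : FinGraph.{u}) : ℕ := Nat.card G.V

/-- The `d`-th power of `G`: same vertices, two distinct vertices being adjacent if and only if
their distance in `G` is at most `d` (the distance is infinite between different components). -/
def power (G : FinGraph.{u}) (d : ℕ) : FinGraph.{u} where
  V := G.V
  graph :=
    { Adj := fun v w => v ≠ w ∧ G.graph.edist v w ≤ (d : ℕ∞)
      symm := ⟨fun v w h => ⟨h.1.symm, by rw [SimpleGraph.edist_comm]; exact h.2⟩⟩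
      loopless := ⟨fun _ h => h.1 rfl⟩ }

/-- The class of `d`-th powers of the graphs from `C`. -/
def powerClass (C : Set FinGraph.{u}) (d : ℕ) : Set FinGraph.{u} :=
  {H | ∃ G ∈ C, H = G.power d}

/-- The hereditary closure of `C`: all graphs isomorphic to an induced subgraph
of a graph from `C`. -/
def hereditaryClosure (C : Set FinGraph.{u}) : Set FinGraph.{u} :=
  {H | ∃ G ∈ C, Nonempty (H.graph ↪g G.graph)}

/-- `H` is a depth-`r` minor of `G`: there are pairwise disjoint connected subgraphs of `G` of
radius at most `r`, one for every vertex of `H`, such that adjacent vertices of `H` have subgraphs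
joined by an edge of `G`. So `H` arises from a subgraph of `G` by contracting these subgraphs. -/
def IsDepthMinor (r : ℕ) (H G : FinGraph.{u}) : Prop :=
  ∃ B : H.V → G.graph.Subgraph,
    (∀ x, (B x).coe.Connected ∧ (B x).coe.radius ≤ (r : ℕ∞)) ∧
    (∀ x y, x ≠ y → Disjoint (B x).verts (B y).verts) ∧
    (∀ x y, H.graph.Adj x y → ∃ v ∈ (B x).verts, ∃ w ∈ (B y).verts, G.graph.Adj v w)

/-- `C` is nowhere dense: for every `r`, the clique numbers of the depth-`r` minors of the graphs
from `C` are bounded. -/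
def NowhereDense (C : Set FinGraph.{u}) : Prop :=
  ∀ r : ℕ, ∃ t : ℕ, ∀ G ∈ C, ∀ H : FinGraph.{u}, IsDepthMinor r H G → H.graph.cliqueNum ≤ t

/-- The set of inclusion-wise maximal cliques. -/
def maximalCliques (G : FinGraph.{u}) : Set (Set G.V) :=
  {K | Maximal G.graph.IsClique K}

/-- The closed neighborhood `N[v]`. -/
def closedNeighborhood (G : FinGraph.{u}) (v : G.V) : Set G.V :=
  insert v (G.graph.neighborSet v)

end FinGraph

/-! ### Random access machines

The machine has number registers and arrays of numbers with indirect addressing. Its only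
arithmetic operations are addition and truncated subtraction, so that the number of steps is
polynomially related to the running time of a Turing machine. A program mentions finitely many
registers and arrays. -/

namespace Ram

/-- A memory state. -/
structure State where
  /-- the contents of the registers -/
  reg : ℕ → ℕ
  /-- `arr a x` is the cell with address `x` of the array `a` -/
  arr : ℕ → ℕ → ℕ

/-- The elementary instructions. -/
inductive Instr where
  /-- `const r c`: register `r` receives the number `c` -/
  | const (r c : ℕ)
  /-- `add r s t`: register `r` receives the sum of registers `s` and `t` -/
  | add (r s t : ℕ)
  /-- `sub r s t`: register `r` receives the truncated difference of registers `s` and `t` -/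
  | sub (r s t : ℕ)
  /-- `load r a s`: register `r` receives the cell of array `a` whose address is in register `s` -/
  | load (r a s : ℕ)
  /-- `store a s t`: the cell of array `a` whose address is in register `s` receives register `t` -/
  | store (a s t : ℕ)

/-- The effect of an elementary instruction. -/
def Instr.apply : Instr → State → State
  | .const r c, σ => { σ with reg := Function.update σ.reg r c }
  | .add r s t, σ => { σ with reg := Function.update σ.reg r (σ.reg s + σ.reg t) }
  | .sub r s t, σ => { σ with reg := Function.update σ.reg r (σ.reg s - σ.reg t) }
  | .load r a s, σ => { σ with reg := Function.update σ.reg r (σ.arr a (σ.reg s)) }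
  | .store a s t, σ =>
      { σ with arr := Function.update σ.arr a
                        (Function.update (σ.arr a) (σ.reg s) (σ.reg t)) }

/-- Programs. Tests ask whether a register is nonzero. -/
inductive Prog where
  | skip
  | instr (i : Instr)
  | seq (P Q : Prog)
  | ite (r : ℕ) (P Q : Prog)
  | while (r : ℕ) (P : Prog)

/-- `Runs P σ t τ`: the program `P`, started in the state `σ`, halts after `t` steps in the
state `τ`. Every elementary instruction and every test counts as one step. -/
inductive Runs : Prog → State → ℕ → State → Prop
  | skip (σ : State) : Runs .skip σ 0 σ
  | instr (i : Instr) (σ : State) : Runs (.instr i) σ 1 (i.apply σ)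
  | seq {P Q : Prog} {σ τ υ : State} {t t' : ℕ} :
      Runs P σ t τ → Runs Q τ t' υ → Runs (.seq P Q) σ (t + t') υ
  | ite_true {r : ℕ} {P Q : Prog} {σ τ : State} {t : ℕ} :
      σ.reg r ≠ 0 → Runs P σ t τ → Runs (.ite r P Q) σ (t + 1) τ
  | ite_false {r : ℕ} {P Q : Prog} {σ τ : State} {t : ℕ} :
      σ.reg r = 0 → Runs Q σ t τ → Runs (.ite r P Q) σ (t + 1) τ
  | while_true {r : ℕ} {P : Prog} {σ τ υ : State} {t t' : ℕ} :
      σ.reg r ≠ 0 → Runs P σ t τ → Runs (.while r P) τ t' υ →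
      Runs (.while r P) σ (t + t' + 1) υ
  | while_false {r : ℕ} {P : Prog} {σ : State} :
      σ.reg r = 0 → Runs (.while r P) σ 1 σ

open Classical in
/-- The initial state for the input graph `G`, whose `n` vertices are numbered by `e`: register `0`
holds `n`, array `0` holds the adjacency matrix row by row, and everything else is zero. -/
noncomputable def inputState (G : FinGraph.{u}) (e : Fin G.order ≃ G.V) : State where
  reg r := if r = 0 then G.order else 0
  arr a x :=
    if a = 0 ∧ ∃ i j : Fin G.order, x = i * G.order + j ∧ G.graph.Adj (e i) (e j) then 1 else 0

/-- The `i`-th vertex set written in array `1`: the cells `i * n, …, i * n + n - 1` hold its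
characteristic vector. -/
def outputSet (G : FinGraph.{u}) (e : Fin G.order ≃ G.V) (σ : State) (i : ℕ) : Set G.V :=
  {v | σ.arr 1 (i * G.order + e.symm v) = 1}

/-- In the state `σ`, register `1` holds a number `k`, and the first `k` vertex sets written in
array `1` are exactly the members of `F`, each listed once. -/
def Lists (G : FinGraph.{u}) (e : Fin G.order ≃ G.V) (σ : State) (F : Set (Set G.V)) : Prop :=
  Set.BijOn (outputSet G e σ) (Set.Iio (σ.reg 1)) F

end Ram

/-! A maximal clique `K` of `H` is exactly a set that equals the intersection of the closed
neighborhoods of its own members (`mem_maximalCliques_iff`). Take `A ⊆ K` inclusion-minimal with `K`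
still the intersection over `A`. By minimality each `a ∈ A` has a vertex `v a` that lies in `N[b]`
for all other `b ∈ A` but not in `N[a]`. If `H` is induced in the `d`-th power of `G`, this says
that `b` and `v a` are at distance at most `d` in `G` if and only if `a ≠ b`. So it suffices to
bound such co-matchings (`NowhereDense.exists_comatching_bound`).

This bound comes from uniform quasi-wideness: among many `a i`, many have pairwise disjoint
`d`-balls once a bounded set `S` is isolated. By pigeonhole three of them have the same distances up
to `d` to all vertices of `S`. The partner `v i` of the first is close to the other two. A short
path through `S` could be rerouted to start at `a i`, which is excluded, so both short paths avoid
`S` and `v i` lies in two disjoint balls.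

Quasi-wideness (`NowhereDense.uniformlyQuasiWide`) is proved by induction on the radius. Ramsey's
theorem makes the disjoint balls pairwise nonadjacent, and `exists_scattered_or_linked` makes the
next larger balls disjoint off a bounded set; every failure yields a shallow clique minor that is
too large.

Since `q` vertices determine a maximal clique, there are at most `n ^ q` of them. The program
intersects all `q`-tuples of rows of the reflexive adjacency matrix, keeps the sets satisfying the
fixed-point equation, and discards repetitions. Only maximal cliques are ever listed, so their
polynomial number bounds the cost of the duplicate test. -/

/-! ### Ramsey-type lemmas -/

open Classical in
/-- If every nonempty subset has a vertex of bounded degree, a large set has a large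
independent set. -/
lemma exists_independent_of_degenerate {α : Type*} (T : α → α → Prop)
    (hT : ∀ x y, T x y → T y x) (D m : ℕ) (hD : 0 < D) (A : Finset α) (hA : m * D ≤ A.card)
    (hdeg : ∀ B ⊆ A, B.Nonempty → ∃ x ∈ B, (B.filter (fun y => y = x ∨ T x y)).card ≤ D) :
    ∃ A' ⊆ A, m ≤ A'.card ∧ ∀ x ∈ A', ∀ y ∈ A', x ≠ y → ¬ T x y := by
  induction m generalizing A with
  | zero => exact ⟨∅, by simp, by simp, by simp⟩
  | succ m ih =>
    rcases A.eq_empty_or_nonempty with rfl | hne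
    · rw [Finset.card_empty, Nat.succ_mul] at hA
      omega
    obtain ⟨x, hx, hYc⟩ := hdeg A subset_rfl hne
    set Y := A.filter (fun y => y = x ∨ T x y) with hY
    have hsub : Y ⊆ A := Finset.filter_subset _ _
    -- Greedy choice: `x` is kept and its closed neighborhood, at most `D` elements, is discarded.
    obtain ⟨A', hA', hc, hi⟩ := ih (A \ Y) (by
      rw [Finset.card_sdiff_of_subset hsub, Nat.succ_mul] at *
      omega) (fun B hB => hdeg B (hB.trans Finset.sdiff_subset))
    have hx' : ∀ y ∈ A', y ≠ x ∧ ¬ T x y := by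
      intro y hy
      have := hA' hy
      simp only [hY, Finset.mem_sdiff, Finset.mem_filter, not_and, not_or] at this
      exact this.2 this.1
    refine ⟨insert x A', ?_, ?_, ?_⟩
    · exact Finset.insert_subset hx (hA'.trans Finset.sdiff_subset)
    · rw [Finset.card_insert_of_notMem (fun h => (hx' x h).1 rfl)]
      omega
    · intro y hy z hz hyz
      rw [Finset.mem_insert] at hy hz
      rcases hy with rfl | hy <;> rcases hz with rfl | hz
      · exact absurd rfl hyz
      · exact (hx' z hz).2
      · exact fun h => (hx' y hy).2 (hT _ _ h)
      · exact hi y hy z hz hyz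

open Classical in
/-- A relation of bounded degree on a large set has a large independent set. -/
lemma exists_independent_of_degree_le {α : Type*} (T : α → α → Prop) (hT : ∀ x y, T x y → T y x)
    (D m : ℕ) (hD : 0 < D) (A : Finset α) (hA : m * D ≤ A.card)
    (hdeg : ∀ x ∈ A, (A.filter (fun y => y = x ∨ T x y)).card ≤ D) :
    ∃ A' ⊆ A, m ≤ A'.card ∧ ∀ x ∈ A', ∀ y ∈ A', x ≠ y → ¬ T x y :=
  exists_independent_of_degenerate T hT D m hD A hA fun _ hB ⟨x, hx⟩ =>
    ⟨x, hx, (Finset.card_le_card (Finset.filter_subset_filter _ hB)).trans (hdeg x (hB hx))⟩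

open Classical in
/-- A relation of bounded out-degree on a large set has a large independent set. -/
lemma exists_independent_of_outdegree_le {α : Type*} (R : α → α → Prop) (D m : ℕ)
    (A : Finset α) (hA : m * (2 * D + 1) ≤ A.card)
    (hdeg : ∀ x ∈ A, (A.filter (fun y => R x y)).card ≤ D) :
    ∃ A' ⊆ A, m ≤ A'.card ∧ ∀ x ∈ A', ∀ y ∈ A', x ≠ y → ¬ R x y := by
  obtain ⟨A', hA', hc, h⟩ := exists_independent_of_degenerate (fun x y => R x y ∨ R y x)
    (fun x y h => h.symm) (2 * D + 1) m (by omega) A hA (by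
      intro B hB hne
      have hout : ∀ x ∈ B, (B.filter (fun y => R x y)).card ≤ D := fun x hx =>
        (Finset.card_le_card (Finset.filter_subset_filter _ hB)).trans (hdeg x (hB hx))
      -- In-degrees and out-degrees have the same sum, so some in-degree is at most `D`. Counting
      -- the vertex itself gives the constant `2 * D + 1`.
      obtain ⟨x, hx, hin⟩ : ∃ x ∈ B, (B.filter (fun y => R y x)).card ≤ D := by
        refine Finset.exists_le_of_sum_le hne ?_
        calc ∑ x ∈ B, (B.filter (fun y => R y x)).card
            = ∑ x ∈ B, (B.filter (fun y => R x y)).card :=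
              (Finset.sum_card_bipartiteAbove_eq_sum_card_bipartiteBelow R).symm
          _ ≤ ∑ _x ∈ B, D := Finset.sum_le_sum hout
      refine ⟨x, hx, ?_⟩
      refine (Finset.card_le_card (t := insert x (B.filter (fun y => R x y) ∪
        B.filter (fun y => R y x))) fun y hy => ?_).trans ((Finset.card_insert_le _ _).trans ?_)
      · simp only [Finset.mem_filter, Finset.mem_insert, Finset.mem_union] at hy ⊢
        tauto
      have := Finset.card_union_le (B.filter (fun y => R x y)) (B.filter (fun y => R y x))
      have := hout x hx
      omega)
  exact ⟨A', hA', hc, fun x hx y hy hxy hR => h x hx y hy hxy (Or.inl hR)⟩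

/-- Ramsey's theorem for a symmetric relation. -/
lemma exists_ramsey (t m : ℕ) : ∃ N : ℕ, ∀ {α : Type u} (T : α → α → Prop),
    (∀ x y, T x y → T y x) → ∀ A : Finset α, N ≤ A.card →
      (∃ a : Fin t → α, Function.Injective a ∧ (∀ i, a i ∈ A) ∧ ∀ i j, i < j → T (a i) (a j)) ∨
      ∃ A' ⊆ A, m ≤ A'.card ∧ ∀ x ∈ A', ∀ y ∈ A', x ≠ y → ¬ T x y := by
  classical
  induction t with
  | zero =>
    exact ⟨0, fun T _ A _ => Or.inl ⟨Fin.elim0, fun i => i.elim0, fun i => i.elim0,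
      fun i => i.elim0⟩⟩
  | succ t ih =>
    obtain ⟨N, hN⟩ := ih
    refine ⟨m * (N + 1), fun {α} T hT A hA => ?_⟩
    -- Either all degrees are small and the greedy argument applies, or a vertex of large degree is
    -- prepended to a clique found among its neighbors.
    by_cases h : ∀ x ∈ A, (A.filter (fun y => y = x ∨ T x y)).card ≤ N + 1
    · exact Or.inr (exists_independent_of_degree_le T hT (N + 1) m N.succ_pos A hA h)
    push Not at h
    obtain ⟨x, hx, hYc⟩ := h
    set Y := A.filter (fun y => y = x ∨ T x y)
    have hYA : Y ⊆ A := Finset.filter_subset _ _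
    have hY : ∀ y ∈ Y, y = x ∨ T x y := fun y hy => (Finset.mem_filter.mp hy).2
    have hcard : N ≤ (Y.erase x).card := by
      have := Finset.pred_card_le_card_erase (s := Y) (a := x)
      omega
    rcases hN T hT (Y.erase x) hcard with ⟨a, ha, haA, haT⟩ | ⟨A', hA', h⟩
    · refine Or.inl ⟨Fin.cons x a, ?_, ?_, ?_⟩
      · rw [Fin.cons_injective_iff]
        refine ⟨?_, ha⟩
        rintro ⟨i, hi⟩
        exact Finset.ne_of_mem_erase (haA i) hi
      · intro i
        refine Fin.cases hx (fun i => ?_) i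
        exact hYA (Finset.mem_of_mem_erase (haA i))
      · intro i j hij
        induction j using Fin.cases with
        | zero => exact absurd hij (Fin.not_lt_zero i)
        | succ j =>
          induction i using Fin.cases with
          | zero =>
            exact (hY _ (Finset.mem_of_mem_erase (haA j))).resolve_left
              (Finset.ne_of_mem_erase (haA j))
          | succ i => exact haT i j (Fin.succ_lt_succ_iff.mp hij)
    · exact Or.inr ⟨A', hA'.trans ((Finset.erase_subset _ _).trans hYA), h⟩

/-- A family of vertices of `A` linked by common neighbors that can be assigned disjointly to
the vertices. -/
def Linked {α : Type u} (R : α → α → Prop) (A : Finset α) (t : ℕ) : Prop :=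
  ∃ (a : Fin t → α) (b : Fin t → Fin t → α), Function.Injective a ∧ (∀ i, a i ∈ A) ∧
    (∀ i j, i < j → R (b i j) (a i) ∧ R (b i j) (a j)) ∧
    ∀ i j k l, i < j → k < l → b i j = b k l → i = k

lemma Linked.mono {α : Type u} {R : α → α → Prop} {A B : Finset α} {t : ℕ} (h : A ⊆ B) :
    Linked R A t → Linked R B t := fun ⟨a, b, ha, haA, hb⟩ => ⟨a, b, ha, fun i => h (haA i), hb⟩

/-- No vertex outside `F` is a common neighbor of two elements of `A`. -/
def Scattered {α : Type u} (R : α → α → Prop) (F A : Finset α) : Prop :=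
  ∀ x ∈ A, ∀ y ∈ A, x ≠ y → ∀ z, z ∉ F → ¬ (R z x ∧ R z y)

-- Induction on `t`. Call two elements in conflict if they have a common neighbor outside `F`. If
-- conflicts have bounded degree, a greedy choice is scattered. Otherwise some `x` conflicts with
-- many `y`, with witnesses `f y`. As each witness has at most `D` neighbors in `A`, the `y` can be
-- thinned to `W` so that no `f y` is related to another element of `W`; a linked family in `W` is
-- then extended by `x`.
open Classical in
lemma exists_scattered_or_linked_of_degree_le (D t m : ℕ) : ∃ N : ℕ, ∀ {α : Type u}
    (R : α → α → Prop) (F A : Finset α), N ≤ A.card →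
      (∀ z, z ∉ F → (A.filter (fun x => R z x)).card ≤ D) →
      Linked R A t ∨ ∃ A' ⊆ A, m ≤ A'.card ∧ Scattered R F A' := by
  induction t with
  | zero =>
    exact ⟨0, fun R F A _ _ => Or.inl ⟨Fin.elim0, fun i => i.elim0, fun i => i.elim0,
      fun i => i.elim0, fun i => i.elim0, fun i => i.elim0⟩⟩
  | succ t ih =>
    obtain ⟨N, hN⟩ := ih
    set M := N * (2 * D + 1) with hM
    refine ⟨m * (M + 1), fun {α} R F A hA hD => ?_⟩
    by_cases h : ∀ x ∈ A, (A.filter (fun y => y = x ∨ ∃ z, z ∉ F ∧ R z x ∧ R z y)).card ≤ M + 1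
    · obtain ⟨A', hA', hc, hi⟩ := exists_independent_of_degree_le
        (fun x y => ∃ z, z ∉ F ∧ R z x ∧ R z y)
        (fun x y ⟨z, h1, h2, h3⟩ => ⟨z, h1, h3, h2⟩) (M + 1) m M.succ_pos A hA h
      exact Or.inr ⟨A', hA', hc, fun x hx y hy hxy z hz hR => hi x hx y hy hxy ⟨z, hz, hR⟩⟩
    push Not at h
    obtain ⟨x, hx, hYc⟩ := h
    set Y := A.filter (fun y => y = x ∨ ∃ z, z ∉ F ∧ R z x ∧ R z y)
    have hcard : M ≤ (Y.erase x).card := by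
      have := Finset.pred_card_le_card_erase (s := Y) (a := x)
      omega
    have hYx : ∀ y ∈ Y.erase x, ∃ z, z ∉ F ∧ R z x ∧ R z y := fun y hy =>
      ((Finset.mem_filter.mp (Finset.mem_of_mem_erase hy)).2).resolve_left
        (Finset.ne_of_mem_erase hy)
    have hYA : Y.erase x ⊆ A := (Finset.erase_subset _ _).trans (Finset.filter_subset _ _)
    choose! f hf using hYx
    obtain ⟨W, hWY, hWc, hW⟩ := exists_independent_of_outdegree_le (fun y y' => R (f y) y') D N
      (Y.erase x) hcard (fun y hy =>
        (Finset.card_le_card (Finset.filter_subset_filter _ hYA)).trans (hD _ (hf y hy).1))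
    rcases hN R F W hWc (fun z hz => (Finset.card_le_card (Finset.filter_subset_filter _
      (hWY.trans hYA))).trans (hD z hz)) with ⟨a, b, ha, haA, hb, hbi⟩ | ⟨A', hA', hc, h⟩
    swap
    · exact Or.inr ⟨A', hA'.trans (hWY.trans hYA), hc, h⟩
    -- A connector `b i j` is related to two elements of `W`, whereas a witness is related to only
    -- one.
    have hfb : ∀ i j l, i < j → f (a l) ≠ b i j := by
      intro i j l hij hfl
      by_cases hl : l = i
      · refine hW (a l) (haA l) (a j) (haA j) (ha.ne fun h => hij.ne (hl.symm.trans h)) ?_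
        rw [hfl]
        exact (hb i j hij).2
      · refine hW (a l) (haA l) (a i) (haA i) (ha.ne hl) ?_
        rw [hfl]
        exact (hb i j hij).1
    refine Or.inl ⟨Fin.cons x a, Fin.cons (Fin.cons x (fun j => f (a j)))
      (fun i => Fin.cons x (b i)), ?_, ?_, ?_, ?_⟩
    · rw [Fin.cons_injective_iff]
      refine ⟨?_, ha⟩
      rintro ⟨i, hi⟩
      exact Finset.ne_of_mem_erase (hWY (haA i)) hi
    · intro i
      exact Fin.cases hx (fun i => hYA (hWY (haA i))) i
    · intro i j hij
      induction j using Fin.cases with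
      | zero => exact absurd hij (Fin.not_lt_zero i)
      | succ j =>
        induction i using Fin.cases with
        | zero => exact (hf _ (hWY (haA j))).2
        | succ i => exact hb i j (Fin.succ_lt_succ_iff.mp hij)
    · intro i j k l hij hkl hbb
      induction j using Fin.cases with
      | zero => exact absurd hij (Fin.not_lt_zero i)
      | succ j =>
        induction l using Fin.cases with
        | zero => exact absurd hkl (Fin.not_lt_zero k)
        | succ l =>
          induction i using Fin.cases with
          | zero =>
            induction k using Fin.cases with
            | zero => rfl
            | succ k => exact absurd hbb (hfb k l j (Fin.succ_lt_succ_iff.mp hkl))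
          | succ i =>
            induction k using Fin.cases with
            | zero => exact absurd hbb.symm (hfb i j l (Fin.succ_lt_succ_iff.mp hij))
            | succ k =>
              simp only [Fin.cons_succ] at hbb
              rw [hbi i j k l (Fin.succ_lt_succ_iff.mp hij) (Fin.succ_lt_succ_iff.mp hkl) hbb]

/-- Induction on `h`. If some `z` outside `F` has many neighbors in `A`, the argument continues
inside these neighbors with `z` added to `F`. Afterwards `z` joins either the exceptional set `S` or
the side `c` of the biclique. If there is no such `z`, the bounded-degree case applies. The set `F`
keeps the vertices chosen for `c` distinct. -/
lemma exists_scattered_or_linked_or_biclique (t h m : ℕ) : ∃ N : ℕ, ∀ {α : Type u}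
    (R : α → α → Prop) (F A : Finset α), N ≤ A.card →
      Linked R A t ∨
      (∃ S : Finset α, S.card ≤ h ∧ ∃ A' ⊆ A, m ≤ A'.card ∧
        ∀ x ∈ A', ∀ y ∈ A', x ≠ y → ∀ z, z ∉ F → z ∉ S → ¬ (R z x ∧ R z y)) ∨
      ∃ c : Fin h → α, Function.Injective c ∧ (∀ i, c i ∉ F) ∧ ∃ A' ⊆ A, t ≤ A'.card ∧
        ∀ i, ∀ x ∈ A', R (c i) x := by
  classical
  induction h with
  | zero =>
    exact ⟨t, fun R F A hA => Or.inr (Or.inr ⟨Fin.elim0, fun i => i.elim0, fun i => i.elim0,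
      A, subset_rfl, hA, fun i => i.elim0⟩)⟩
  | succ h ih =>
    obtain ⟨N₁, h₁⟩ := ih
    obtain ⟨N₂, h₂⟩ := exists_scattered_or_linked_of_degree_le.{u} N₁ t m
    refine ⟨N₂, fun {α} R F A hA => ?_⟩
    by_cases hD : ∀ z, z ∉ F → (A.filter (fun x => R z x)).card ≤ N₁
    · rcases h₂ R F A hA hD with h | ⟨A', hA', hc, h⟩
      · exact Or.inl h
      · exact Or.inr (Or.inl ⟨∅, by simp, A', hA', hc,
          fun x hx y hy hxy z hz _ => h x hx y hy hxy z hz⟩)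
    push Not at hD
    obtain ⟨z, hz, hzc⟩ := hD
    have hsub : A.filter (fun x => R z x) ⊆ A := Finset.filter_subset _ _
    rcases h₁ R (insert z F) _ hzc.le with
      h | ⟨S, hS, A', hA', hc, h⟩ | ⟨c, hc, hcF, A', hA', hc', h⟩
    · exact Or.inl (h.mono hsub)
    · refine Or.inr (Or.inl ⟨insert z S, (Finset.card_insert_le _ _).trans
        (Nat.succ_le_succ hS), A', hA'.trans hsub, hc, fun x hx y hy hxy w hw hwS => ?_⟩)
      rw [Finset.mem_insert, not_or] at hwS
      refine h x hx y hy hxy w ?_ hwS.2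
      rw [Finset.mem_insert, not_or]
      exact ⟨hwS.1, hw⟩
    · refine Or.inr (Or.inr ⟨Fin.cons z c, ?_, ?_, A', hA'.trans hsub, hc', ?_⟩)
      · rw [Fin.cons_injective_iff]
        refine ⟨?_, hc⟩
        rintro ⟨i, hi⟩
        exact hcF i (hi ▸ Finset.mem_insert_self _ _)
      · exact fun i => Fin.cases hz
          (fun i hi => hcF i (Finset.mem_insert_of_mem hi)) i
      · intro i x hx
        exact Fin.cases (Finset.mem_filter.mp (hA' hx)).2 (fun i => h i x hx) i

/-- In a bipartite relation one finds either many vertices that have pairwise no common neighbor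
outside a bounded set, or a linked family. -/
lemma exists_scattered_or_linked (t m : ℕ) : ∃ N : ℕ, ∀ {α : Type u} (R : α → α → Prop)
    (A : Finset α), N ≤ A.card →
      Linked R A t ∨
      ∃ S : Finset α, S.card ≤ t ∧ ∃ A' ⊆ A, m ≤ A'.card ∧ Scattered R S A' := by
  obtain ⟨N, hN⟩ := exists_scattered_or_linked_or_biclique.{u} t t m
  refine ⟨N, fun {α} R A hA => ?_⟩
  rcases hN R ∅ A hA with h | ⟨S, hS, A', hA', hc, h⟩ | ⟨c, hc, -, A', hA', hc', h⟩
  · exact Or.inl h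
  · exact Or.inr ⟨S, hS, A', hA', hc,
      fun x hx y hy hxy z hz => h x hx y hy hxy z (Finset.notMem_empty z) hz⟩
  · obtain ⟨B, hB, hBc⟩ := Finset.exists_subset_card_eq hc'
    have e : Fin t ≃ B := (finCongr hBc.symm).trans B.equivFin.symm
    -- A biclique is itself a linked family: `c i` serves as the connector of `i` to every later
    -- index.
    exact Or.inl ⟨fun i => (e i).1, fun i _ => c i,
      Subtype.val_injective.comp e.injective, fun i => hA' (hB (e i).2),
      fun i j _ => ⟨h i _ (hB (e i).2), h i _ (hB (e j).2)⟩, fun i j k l _ _ hik => hc hik⟩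

/-! ### Balls and shallow clique minors -/

namespace SimpleGraph

variable {V : Type u}

lemma exists_walk_length_le_of_edist_le {G : SimpleGraph V} {u v : V} {k : ℕ}
    (h : G.edist u v ≤ k) : ∃ p : G.Walk u v, p.length ≤ k := by
  obtain ⟨p, hp⟩ := G.exists_walk_of_edist_ne_top (ne_top_of_le_ne_top (ENat.natCast_ne_top k) h)
  refine ⟨p, ?_⟩
  rw [← hp] at h
  exact_mod_cast h

lemma edist_le_succ_cases {G : SimpleGraph V} {u v : V} {k : ℕ}
    (h : G.edist u v ≤ (k + 1 : ℕ)) : G.edist u v ≤ k ∨ ∃ w, G.edist u w ≤ k ∧ G.Adj w v := by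
  -- Reversing the walk makes its last edge the one exposed by `cons`.
  rw [edist_comm] at h
  obtain ⟨p, hp⟩ := exists_walk_length_le_of_edist_le h
  cases p with
  | nil => left; simp
  | cons hadj q =>
    right
    refine ⟨_, ?_, hadj.symm⟩
    rw [edist_comm]
    refine q.edist_le.trans ?_
    rw [Walk.length_cons] at hp
    exact_mod_cast Nat.le_of_succ_le_succ hp

lemma edist_le_succ_of_adj {G : SimpleGraph V} {u v w : V} {k : ℕ}
    (h : G.edist u v ≤ k) (hvw : G.Adj v w) : G.edist u w ≤ (k + 1 : ℕ) := by
  refine G.edist_triangle.trans ((add_le_add h (edist_eq_one_iff_adj.mpr hvw).le).trans ?_)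
  exact_mod_cast le_rfl

/-- The graph `G` with all edges at vertices of `S` deleted. -/
def isolate (G : SimpleGraph V) (S : Set V) : SimpleGraph V where
  Adj x y := G.Adj x y ∧ x ∉ S ∧ y ∉ S
  symm := ⟨fun _ _ h => ⟨h.1.symm, h.2.2, h.2.1⟩⟩
  loopless := ⟨fun _ h => G.loopless.irrefl _ h.1⟩

lemma isolate_le (G : SimpleGraph V) (S : Set V) : G.isolate S ≤ G := fun _ _ h => h.1

lemma isolate_anti (G : SimpleGraph V) {S T : Set V} (h : S ⊆ T) : G.isolate T ≤ G.isolate S :=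
  fun _ _ hxy => ⟨hxy.1, fun hx => hxy.2.1 (h hx), fun hy => hxy.2.2 (h hy)⟩

/-- Vertices of `S` remain as isolated points. For this reason the subsets in quasi-wideness need
not avoid `S`. -/
lemma eq_of_edist_isolate_le {G : SimpleGraph V} {S : Set V} {u v : V} {k : ℕ}
    (hv : v ∈ S) (h : (G.isolate S).edist u v ≤ k) : u = v := by
  rw [edist_comm] at h
  obtain ⟨p, -⟩ := exists_walk_length_le_of_edist_le h
  cases p with
  | nil => rfl
  | cons hadj q => exact absurd hv hadj.2.1

/-- A short walk either avoids `S` or passes through a vertex of `S`. -/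
lemma edist_isolate_or_through {G : SimpleGraph V} (S : Set V) {u v : V} {k : ℕ}
    (h : G.edist u v ≤ k) :
    (G.isolate S).edist u v ≤ k ∨ ∃ s ∈ S, G.edist u s + G.edist s v ≤ k := by
  obtain ⟨p, hp⟩ := exists_walk_length_le_of_edist_le h
  clear h
  induction p generalizing k with
  | nil => left; simp
  | @cons u w v hadj q ih =>
    rw [Walk.length_cons] at hp
    obtain ⟨k, rfl⟩ : ∃ l, k = l + 1 := ⟨k - 1, by omega⟩
    have hone : G.edist u w ≤ 1 := (edist_eq_one_iff_adj.mpr hadj).le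
    by_cases hu : u ∈ S
    · refine Or.inr ⟨u, hu, ?_⟩
      rw [edist_self, zero_add]
      refine (Walk.cons hadj q).edist_le.trans ?_
      exact_mod_cast hp
    by_cases hw : w ∈ S
    · refine Or.inr ⟨w, hw, (add_le_add hone (q.edist_le.trans
        (Nat.cast_le.mpr (Nat.le_of_succ_le_succ hp)))).trans ?_⟩
      rw [add_comm]
      exact_mod_cast le_rfl
    rcases ih (Nat.le_of_succ_le_succ hp) with h | ⟨s, hs, h⟩
    · left
      rw [edist_comm] at h ⊢
      exact edist_le_succ_of_adj h ⟨hadj.symm, hw, hu⟩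
    · refine Or.inr ⟨s, hs, ?_⟩
      calc G.edist u s + G.edist s v ≤ (G.edist u w + G.edist w s) + G.edist s v :=
            add_le_add G.edist_triangle le_rfl
        _ = G.edist u w + (G.edist w s + G.edist s v) := add_assoc _ _ _
        _ ≤ 1 + (k : ℕ∞) := add_le_add hone h
        _ = ((k + 1 : ℕ) : ℕ∞) := by rw [add_comm]; push_cast; rfl

/-- Distances from the centre of a ball are not increased by passing to a set
containing the ball. -/
lemma edist_induce_le {G : SimpleGraph V} {c x : V} {k : ℕ} {B : Set V}
    (hB : ∀ y, G.edist c y ≤ k → y ∈ B) (hc : c ∈ B) (hx : x ∈ B) (h : G.edist c x ≤ k) :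
    (G.induce B).edist ⟨c, hc⟩ ⟨x, hx⟩ ≤ k := by
  induction k generalizing x with
  | zero =>
    have : c = x := by simpa using h
    subst this
    simp
  | succ k ih =>
    have hle : ∀ y, G.edist c y ≤ k → G.edist c y ≤ (k + 1 : ℕ) := fun y hy =>
      hy.trans (by exact_mod_cast Nat.le_succ k)
    rcases edist_le_succ_cases h with h | ⟨w, hw, hadj⟩
    · exact (ih (fun y hy => hB y (hle y hy)) hx h).trans (by exact_mod_cast Nat.le_succ k)
    · have hwB : w ∈ B := hB w (hle w hw)
      exact edist_le_succ_of_adj (ih (fun y hy => hB y (hle y hy)) hwB hw)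
        (show G.Adj w x from hadj)

lemma connected_and_radius_le (G : SimpleGraph V) (c : V) {r : ℕ} (h : ∀ x, G.edist c x ≤ r) :
    G.Connected ∧ G.radius ≤ r := by
  have hreach : ∀ x, G.Reachable c x := fun x =>
    reachable_of_edist_ne_top (ne_top_of_le_ne_top (ENat.natCast_ne_top r) (h x))
  have : Nonempty V := ⟨c⟩
  exact ⟨⟨fun x y => (hreach x).symm.trans (hreach y)⟩,
    radius_le_eccent.trans ((eccent_le_iff c (r : ℕ∞)).mpr h)⟩

end SimpleGraph

namespace FinGraph

/-- Pairwise adjacent disjoint sets of radius at most `r` form a depth-`r` clique minor. -/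
lemma isDepthMinor_top {G : FinGraph.{u}} {G' : SimpleGraph G.V} (hG : G' ≤ G.graph) {r t : ℕ}
    (c : Fin t → G.V) (B : Fin t → Set G.V) (hc : ∀ i, c i ∈ B i)
    (hr : ∀ i, ∀ x (hx : x ∈ B i), (G'.induce (B i)).edist ⟨c i, hc i⟩ ⟨x, hx⟩ ≤ r)
    (hdisj : ∀ i j, i < j → Disjoint (B i) (B j))
    (hadj : ∀ i j, i < j → ∃ v ∈ B i, ∃ w ∈ B j, G'.Adj v w) :
    IsDepthMinor r ⟨ULift.{u} (Fin t), ⊤⟩ G := by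
  refine ⟨fun i => (⊤ : G.graph.Subgraph).induce (B i.down), fun i => ?_, fun i j hij => ?_,
    fun i j hij => ?_⟩
  · have hle : G'.induce (B i.down) ≤ G.graph.induce (B i.down) := fun x y h => hG h
    have := SimpleGraph.connected_and_radius_le (G.graph.induce (B i.down)) ⟨c i.down, hc _⟩
      (fun x => (SimpleGraph.edist_anti hle).trans (hr _ x.1 x.2))
    rwa [SimpleGraph.induce_eq_coe_induce_top] at this
  · simp only [SimpleGraph.Subgraph.induce_verts]
    rcases lt_trichotomy i.down j.down with h | h | h
    · exact hdisj _ _ h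
    · exact absurd (ULift.ext _ _ h) hij
    · exact (hdisj _ _ h).symm
  · simp only [SimpleGraph.Subgraph.induce_verts]
    have hij' : i ≠ j := hij
    rcases lt_trichotomy i.down j.down with h | h | h
    · obtain ⟨v, hv, w, hw, h⟩ := hadj _ _ h
      exact ⟨v, hv, w, hw, hG h⟩
    · exact absurd (ULift.ext _ _ h) hij'
    · obtain ⟨v, hv, w, hw, h⟩ := hadj _ _ h
      exact ⟨w, hw, v, hv, (hG h).symm⟩

lemma le_of_isDepthMinor_top {G : FinGraph.{u}} {r t k : ℕ}
    (hk : ∀ H : FinGraph.{u}, IsDepthMinor r H G → H.graph.cliqueNum ≤ k)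
    (h : IsDepthMinor r ⟨ULift.{u} (Fin t), ⊤⟩ G) : t ≤ k := by
  refine le_trans ?_ (hk _ h)
  have := SimpleGraph.IsClique.card_le_cliqueNum (G := (⊤ : SimpleGraph (ULift.{u} (Fin t))))
    (t := Finset.univ) (tc := by intro x _ y _ hxy; exact hxy)
  simpa using this

end FinGraph

/-! ### Uniform quasi-wideness -/

namespace FinGraph

/-- Large vertex sets of graphs from `C` contain large subsets whose balls of radius `k` become
pairwise disjoint after the removal of a bounded number of vertices. -/
def UniformlyQuasiWide (C : Set FinGraph.{u}) (k : ℕ) : Prop :=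
  ∃ s : ℕ, ∀ m : ℕ, ∃ N : ℕ, ∀ G ∈ C, ∀ A : Finset G.V, N ≤ A.card →
    ∃ S : Finset G.V, S.card ≤ s ∧ ∃ A' ⊆ A, m ≤ A'.card ∧
      ∀ x ∈ A', ∀ y ∈ A', x ≠ y → ∀ z,
        ¬ ((G.graph.isolate S).edist x z ≤ k ∧ (G.graph.isolate S).edist y z ≤ k)

/-- Pairwise disjoint and pairwise adjacent balls give a clique minor. -/
lemma isDepthMinor_of_balls {G : FinGraph.{u}} {G' : SimpleGraph G.V} (hG : G' ≤ G.graph)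
    {k t : ℕ} (a : Fin t → G.V)
    (hdisj : ∀ i j, i ≠ j → ∀ z, ¬ (G'.edist (a i) z ≤ k ∧ G'.edist (a j) z ≤ k))
    (hadj : ∀ i j, i < j → ∃ u v, G'.edist (a i) u ≤ k ∧ G'.edist (a j) v ≤ k ∧ G'.Adj u v) :
    IsDepthMinor k ⟨ULift.{u} (Fin t), ⊤⟩ G := by
  refine isDepthMinor_top hG a (fun i => {u | G'.edist (a i) u ≤ k}) (fun i => by simp) ?_ ?_ ?_
  · intro i x hx
    exact SimpleGraph.edist_induce_le (fun y hy => hy) _ hx hx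
  · intro i j hij
    exact Set.disjoint_left.mpr fun z hz hz' => hdisj i j hij.ne z ⟨hz, hz'⟩
  · intro i j hij
    obtain ⟨u, v, hu, hv, h⟩ := hadj i j hij
    exact ⟨u, hu, v, hv, h⟩

/-- Pairwise disjoint and nonadjacent balls linked through outside vertices give a clique
minor. -/
lemma isDepthMinor_of_linked_balls {G : FinGraph.{u}} {G' : SimpleGraph G.V} (hG : G' ≤ G.graph)
    {k t : ℕ} (a : Fin t → G.V) (b : Fin t → Fin t → G.V)
    (hdisj : ∀ i j, i ≠ j → ∀ z, ¬ (G'.edist (a i) z ≤ k ∧ G'.edist (a j) z ≤ k))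
    (hnadj : ∀ i j, i ≠ j → ∀ u v, G'.edist (a i) u ≤ k → G'.edist (a j) v ≤ k → ¬ G'.Adj u v)
    (hb : ∀ i j, i < j → G'.edist (a i) (b i j) ≤ (k + 1 : ℕ) ∧
      G'.edist (a j) (b i j) ≤ (k + 1 : ℕ))
    (hbi : ∀ i j k l, i < j → k < l → b i j = b k l → i = k) :
    IsDepthMinor (k + 1) ⟨ULift.{u} (Fin t), ⊤⟩ G := by
  -- Entering the ball of another centre within one more step would make the two balls meet or be
  -- adjacent. Hence the connectors lie outside all balls.
  have hout1 : ∀ i l z, i ≠ l → G'.edist (a i) z ≤ (k + 1 : ℕ) → ¬ G'.edist (a l) z ≤ k := by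
    intro i l z hil hz hl
    rcases SimpleGraph.edist_le_succ_cases hz with h | ⟨w, hw, h⟩
    · exact hdisj i l hil z ⟨h, hl⟩
    · exact hnadj i l hil w z hw hl h
  have hout : ∀ i j l, i < j → ¬ G'.edist (a l) (b i j) ≤ k := by
    intro i j l hij
    by_cases hil : i = l
    · exact hout1 j l _ (fun h => hij.ne (hil.trans h.symm)) (hb i j hij).2
    · exact hout1 i l _ hil (hb i j hij).1
  have hk : ∀ i z, G'.edist (a i) z ≤ k → G'.edist (a i) z ≤ (k + 1 : ℕ) := fun i z h =>
    h.trans (by exact_mod_cast Nat.le_succ k)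
  -- The connector `b i j` is charged to the smaller index: the branch set of `i` is its ball
  -- together with all `b i j`. This is why connectors need to differ only across first indices.
  refine isDepthMinor_top hG a
    (fun i => {u | G'.edist (a i) u ≤ k ∨ ∃ j, i < j ∧ u = b i j}) (fun i => Or.inl (by simp)) ?_ ?_ ?_
  · intro i x hx
    have hx1 : G'.edist (a i) x ≤ (k + 1 : ℕ) := by
      rcases hx with hx | ⟨j, hij, rfl⟩
      · exact hk i x hx
      · exact (hb i j hij).1
    rcases SimpleGraph.edist_le_succ_cases hx1 with h | ⟨w, hw, h⟩
    · exact (SimpleGraph.edist_induce_le (fun y hy => Or.inl hy) _ hx h).trans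
        (by exact_mod_cast Nat.le_succ k)
    · exact SimpleGraph.edist_le_succ_of_adj
        (SimpleGraph.edist_induce_le (fun y hy => Or.inl hy) (Or.inl (by simp)) (Or.inl hw) hw)
        (show G'.Adj w x from h)
  · intro i j hij
    refine Set.disjoint_left.mpr ?_
    rintro z (hz | ⟨l, hl, rfl⟩) (hz' | ⟨l', hl', hz'⟩)
    · exact hdisj i j hij.ne z ⟨hz, hz'⟩
    · subst hz'
      exact hout j l' i hl' hz
    · exact hout i l j hl hz'
    · exact hij.ne (hbi i l j l' hl hl' hz')
  · intro i j hij
    refine ⟨b i j, Or.inr ⟨j, hij, rfl⟩, ?_⟩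
    rcases SimpleGraph.edist_le_succ_cases (hb i j hij).2 with h | ⟨w, hw, h⟩
    · exact absurd h (hout i j j hij)
    -- The penultimate vertex of a shortest path from `a j` to the connector lies in the ball of
    -- `j`.
    · exact ⟨w, Or.inl hw, h.symm⟩

/-- Increasing the radius from `k` to `k + 1` costs at most `t₂ + 1` further isolated vertices,
where `t₂` bounds the depth-`(k + 1)` clique minors. So the bound on `S` does not depend on the size
`m` of the set to be found. -/
theorem NowhereDense.uniformlyQuasiWide {C : Set FinGraph.{u}} (hC : NowhereDense C) (k : ℕ) :
    UniformlyQuasiWide C k := by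
  classical
  induction k with
  | zero =>
    refine ⟨0, fun m => ⟨m, fun G _ A hA => ⟨∅, by simp, A, subset_rfl, hA, ?_⟩⟩⟩
    rintro x _ y _ hxy z ⟨h1, h2⟩
    have h1 : x = z := by simpa using h1
    have h2 : y = z := by simpa using h2
    exact hxy (h1.trans h2.symm)
  | succ k ih =>
    obtain ⟨s, ih⟩ := ih
    obtain ⟨t₁, ht₁⟩ := hC k
    obtain ⟨t₂, ht₂⟩ := hC (k + 1)
    refine ⟨s + (t₂ + 1), fun m => ?_⟩
    obtain ⟨N₁, h₁⟩ := exists_scattered_or_linked.{u} (t₂ + 1) m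
    obtain ⟨N₂, h₂⟩ := exists_ramsey.{u} (t₁ + 1) N₁
    obtain ⟨N, h⟩ := ih N₂
    refine ⟨N, fun G hGC A hA => ?_⟩
    obtain ⟨S, hS, A₀, hA₀, hc₀, hdisj⟩ := h G hGC A hA
    set G' := G.graph.isolate (S : Set G.V) with hG'
    have hle : G' ≤ G.graph := G.graph.isolate_le _
    rcases h₂ (fun x y => ∃ u v, G'.edist x u ≤ k ∧ G'.edist y v ≤ k ∧ G'.Adj u v)
      (fun x y ⟨u, v, hu, hv, huv⟩ => ⟨v, u, hv, hu, huv.symm⟩) A₀ hc₀ with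
      ⟨a, ha, haA, hadj⟩ | ⟨A₁, hA₁, hc₁, hnadj⟩
    · have := le_of_isDepthMinor_top (ht₁ G hGC) (isDepthMinor_of_balls hle a
        (fun i j hij => hdisj _ (haA i) _ (haA j) (ha.ne hij)) hadj)
      omega
    rcases h₁ (fun z x => G'.edist x z ≤ (k + 1 : ℕ)) A₁ hc₁ with
      ⟨a, b, ha, haA, hb, hbi⟩ | ⟨S₁, hS₁, A', hA', hc, hsc⟩
    · have := le_of_isDepthMinor_top (ht₂ G hGC) (isDepthMinor_of_linked_balls hle a b
        (fun i j hij => hdisj _ (hA₁ (haA i)) _ (hA₁ (haA j)) (ha.ne hij))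
        (fun i j hij u v hu hv huv => hnadj _ (haA i) _ (haA j) (ha.ne hij) ⟨u, v, hu, hv, huv⟩)
        hb hbi)
      omega
    · refine ⟨S ∪ S₁, (Finset.card_union_le _ _).trans (Nat.add_le_add hS hS₁), A',
        hA'.trans (hA₁.trans hA₀), hc, ?_⟩
      rintro x hx y hy hxy z ⟨hxz, hyz⟩
      -- Scatteredness says nothing about common vertices in `S₁`, but these are now isolated.
      by_cases hz : z ∈ S₁
      · have hz' : z ∈ ((S ∪ S₁ : Finset G.V) : Set G.V) := by simp [hz]
        exact hxy ((SimpleGraph.eq_of_edist_isolate_le hz' hxz).trans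
          (SimpleGraph.eq_of_edist_isolate_le hz' hyz).symm)
      · have hanti : G.graph.isolate ((S ∪ S₁ : Finset G.V) : Set G.V) ≤ G' :=
          G.graph.isolate_anti (by simp)
        exact hsc x hx y hy hxy z hz
          ⟨(SimpleGraph.edist_anti hanti).trans hxz, (SimpleGraph.edist_anti hanti).trans hyz⟩

end FinGraph

/-! ### Maximal cliques are intersections of few closed neighborhoods -/

namespace FinGraph

/-- In a nowhere dense class, families in which two members are at distance at most `d` if and only
if they have different indices have bounded size. -/
theorem NowhereDense.exists_comatching_bound {C : Set FinGraph.{u}} (hC : NowhereDense C) (d : ℕ) :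
    ∃ M : ℕ, ∀ G ∈ C, ∀ (m : ℕ) (a v : Fin m → G.V),
      (∀ i j, G.graph.edist (a i) (v j) ≤ d ↔ i ≠ j) → m ≤ M := by
  classical
  obtain ⟨s, hs⟩ := hC.uniformlyQuasiWide d
  -- There are at most `2 ^ (s * (d + 1))` distance profiles to `S`; one more than twice this number
  -- forces three equal ones.
  obtain ⟨N, hN⟩ := hs (2 * 2 ^ (s * (d + 1)) + 1)
  refine ⟨N, fun G hG m a v hav => ?_⟩
  by_contra hlt
  have ha : Function.Injective a := by
    intro i j hij
    by_contra hne
    have := (hav i j).mpr hne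
    rw [hij] at this
    exact (hav j j).mp this rfl
  obtain ⟨S, hS, A, hA, hcard, hdisj⟩ := hN G hG (Finset.univ.image a) (by
    rw [Finset.card_image_of_injective _ ha, Finset.card_univ, Fintype.card_fin]
    omega)
  -- The profile of `x` records its distances to the vertices of `S`, truncated beyond `d`.
  set f : G.V → Finset (S × Fin (d + 1)) := fun x =>
    Finset.univ.filter (fun p => G.graph.edist x p.1 ≤ (p.2 : ℕ)) with hf
  obtain ⟨T, -, hT⟩ := Finset.exists_lt_card_fiber_of_mul_lt_card_of_maps_to
    (s := A) (t := Finset.univ) (f := f) (n := 2) (fun _ _ => Finset.mem_univ _) (by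
      rw [Finset.card_univ, Fintype.card_finset, Fintype.card_prod, Fintype.card_coe,
        Fintype.card_fin]
      have : 2 ^ (S.card * (d + 1)) ≤ 2 ^ (s * (d + 1)) :=
        Nat.pow_le_pow_right (by norm_num) (Nat.mul_le_mul_right _ hS)
      omega)
  obtain ⟨x, y, z, hx, hy, hz, hxy, hxz, hyz⟩ := Finset.two_lt_card_iff.mp hT
  rw [Finset.mem_filter] at hx hy hz
  obtain ⟨i, -, rfl⟩ := Finset.mem_image.mp (hA hx.1)
  have hclose : ∀ w ∈ A, a i ≠ w → G.graph.edist w (v i) ≤ d := by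
    intro w hw hne
    obtain ⟨j, -, rfl⟩ := Finset.mem_image.mp (hA hw)
    exact (hav j i).mpr fun h => hne (h ▸ rfl)
  -- If a short path from `w` to `v i` met `S` in `p`, then `a i`, being no farther from `p`, would
  -- also be within `d` of its own partner.
  have hfar : ∀ w ∈ A, a i ≠ w → f w = T → (G.graph.isolate S).edist w (v i) ≤ d := by
    intro w hw hne hwT
    rcases SimpleGraph.edist_isolate_or_through (S : Set G.V) (hclose w hw hne) with h | ⟨p, hp, h⟩
    · exact h
    · exfalso
      have hwp : G.graph.edist w p ≤ d := le_self_add.trans h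
      obtain ⟨k, hk⟩ := ENat.ne_top_iff_exists.mp
        (ne_top_of_le_ne_top (ENat.natCast_ne_top d) hwp)
      have hkd : k ≤ d := by
        rw [← hk] at hwp
        exact_mod_cast hwp
      have hmem : ((⟨p, hp⟩, ⟨k, by omega⟩) : S × Fin (d + 1)) ∈ f w := by
        simp [hf, ← hk]
      rw [hwT, ← hx.2] at hmem
      have hle : G.graph.edist (a i) p ≤ k := by simpa [hf] using hmem
      rw [hk] at hle
      exact (hav i i).mp (G.graph.edist_triangle.trans ((add_le_add hle le_rfl).trans h)) rfl
  exact hdisj y hy.1 z hz.1 hyz (v i) ⟨hfar y hy.1 hxy hy.2, hfar z hz.1 hxz hz.2⟩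

lemma mem_closedNeighborhood_comm {G : FinGraph.{u}} {v w : G.V} :
    v ∈ G.closedNeighborhood w ↔ w ∈ G.closedNeighborhood v := by
  simp only [closedNeighborhood, Set.mem_insert_iff, SimpleGraph.mem_neighborSet]
  rw [eq_comm, SimpleGraph.adj_comm]

/-- A maximal clique is the set of the vertices adjacent or equal to all its members. -/
lemma mem_maximalCliques_iff {G : FinGraph.{u}} {K : Set G.V} :
    K ∈ G.maximalCliques ↔ K = ⋂ a ∈ K, G.closedNeighborhood a := by
  constructor
  · intro hK
    have hK' : Maximal G.graph.IsClique K := hK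
    ext v
    simp only [Set.mem_iInter]
    constructor
    · intro hv a ha
      by_cases h : v = a
      · exact Or.inl h
      · exact Or.inr (hK'.prop ha hv (Ne.symm h))
    · intro h
      refine hK'.le_of_ge (y := insert v K) ?_ (Set.subset_insert v K) (Set.mem_insert v K)
      refine SimpleGraph.IsClique.insert hK'.prop fun a ha hva => ?_
      exact ((h a ha).resolve_left hva).symm
  · intro hK
    have hmem : ∀ v, v ∈ K ↔ ∀ a ∈ K, v ∈ G.closedNeighborhood a := fun v => by
      conv_lhs => rw [hK]
      simp only [Set.mem_iInter]
    refine ⟨fun a ha b hb hab => ?_, fun L hL hKL v hv => ?_⟩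
    · exact ((hmem b).mp hb a ha).resolve_left hab.symm
    · refine (hmem v).mpr fun a ha => ?_
      by_cases h : v = a
      · exact Or.inl h
      · exact Or.inr (hL (hKL ha) hv (Ne.symm h))

lemma mem_closedNeighborhood_iff_edist {G H : FinGraph.{u}} {d : ℕ}
    (φ : H.graph ↪g (G.power d).graph) (v a : H.V) :
    v ∈ H.closedNeighborhood a ↔ G.graph.edist (φ a) (φ v) ≤ d := by
  rw [closedNeighborhood, Set.mem_insert_iff, SimpleGraph.mem_neighborSet, ← φ.map_adj_iff]
  constructor
  · rintro (rfl | h)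
    · exact (SimpleGraph.edist_self (G := G.graph)).le.trans (zero_le)
    · exact h.2
  · intro h
    by_cases hva : v = a
    · exact Or.inl hva
    · exact Or.inr ⟨fun h => hva (φ.injective h).symm, h⟩

/-- A minimal generating subset of `K`, paired with witnesses of the necessity of its members, is a
co-matching in the underlying graph. -/
theorem NowhereDense.exists_small_generating_set {C : Set FinGraph.{u}} (hC : NowhereDense C)
    (d : ℕ) : ∃ q : ℕ, ∀ H ∈ hereditaryClosure (powerClass C d), ∀ K ∈ H.maximalCliques,
      ∃ A : Finset H.V, A.card ≤ q ∧ (A : Set H.V) ⊆ K ∧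
        K = ⋂ a ∈ A, H.closedNeighborhood a := by
  classical
  obtain ⟨M, hM⟩ := hC.exists_comatching_bound d
  refine ⟨M, ?_⟩
  rintro H ⟨_, ⟨G, hG, rfl⟩, ⟨φ⟩⟩ K hK
  have hKeq := mem_maximalCliques_iff.mp hK
  obtain ⟨A, hA⟩ := exists_minimal_of_wellFoundedLT
    (fun A : Finset H.V => (A : Set H.V) ⊆ K ∧ K = ⋂ a ∈ A, H.closedNeighborhood a)
    ⟨K.toFinite.toFinset, by simp, by simpa using hKeq⟩
  refine ⟨A, ?_, hA.prop⟩
  have hKN : ∀ v ∈ K, ∀ a ∈ A, v ∈ H.closedNeighborhood a := by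
    intro v hv a ha
    have := hA.prop.2 ▸ hv
    simp only [Set.mem_iInter] at this
    exact this a ha
  have hv : ∀ a ∈ A, ∃ v, (∀ b ∈ A, b ≠ a → v ∈ H.closedNeighborhood b) ∧
      v ∉ H.closedNeighborhood a := by
    intro a ha
    by_contra! hcon
    have hle := hA.le_of_le (y := A.erase a) ⟨fun b hb => hA.prop.1 (Finset.mem_of_mem_erase hb), ?_⟩
      (Finset.erase_subset a A)
    · exact Finset.notMem_erase a A (hle ha)
    · ext v
      simp only [Set.mem_iInter]
      refine ⟨fun hv b hb => hKN v hv b (Finset.mem_of_mem_erase hb), fun h => ?_⟩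
      have h' : ∀ b ∈ A, b ≠ a → v ∈ H.closedNeighborhood b := fun b hb hba =>
        h b (Finset.mem_erase.mpr ⟨hba, hb⟩)
      rw [hA.prop.2]
      simp only [Set.mem_iInter]
      intro b hb
      by_cases hba : b = a
      · exact hba ▸ hcon v h'
      · exact h' b hb hba
  choose! v hv using hv
  let e := A.equivFin.symm
  refine hM G hG A.card (fun i => φ (e i).1) (fun i => φ (v (e i).1)) fun i j => ?_
  rw [← mem_closedNeighborhood_iff_edist]
  constructor
  · rintro h rfl
    exact (hv _ (e i).2).2 h
  · intro hij
    exact (hv _ (e j).2).1 _ (e i).2 fun h => hij (e.injective (Subtype.ext h))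

lemma ncard_maximalCliques_le {H : FinGraph.{u}} {q : ℕ} (hq : 1 ≤ q) (hH : 1 ≤ H.order)
    (h : ∀ K ∈ H.maximalCliques, ∃ A : Finset H.V, A.card ≤ q ∧ (A : Set H.V) ⊆ K ∧
        K = ⋂ a ∈ A, H.closedNeighborhood a) :
    H.maximalCliques.ncard ≤ H.order ^ q := by
  classical
  have hne : Nonempty H.V := (Nat.card_pos_iff.mp hH).1
  have hsub : H.maximalCliques ⊆
      Set.range (fun f : Fin q → H.V => ⋂ i, H.closedNeighborhood (f i)) := by
    intro K hK
    obtain ⟨A, hAq, hAK, hA⟩ := h K hK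
    obtain ⟨B, hB, hBq, hBK⟩ : ∃ B : Finset H.V, B.Nonempty ∧ B.card ≤ q ∧
        K = ⋂ a ∈ B, H.closedNeighborhood a := by
      rcases A.eq_empty_or_nonempty with rfl | hAne
      -- An empty generating set means that `K` is the whole vertex set. The graph is then complete
      -- and any single vertex generates `K`; this is where `1 ≤ q` is used.
      · obtain ⟨w⟩ := hne
        have hK1 : K = Set.univ := by simpa using hA
        refine ⟨{w}, by simp, by simpa using hq, ?_⟩
        rw [mem_maximalCliques_iff] at hK
        refine (Set.Subset.antisymm ?_ (by simp [hK1]))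
        conv_lhs => rw [hK]
        simp only [Finset.mem_singleton, Set.iInter_iInter_eq_left]
        exact Set.biInter_subset_of_mem (by simp [hK1])
      · exact ⟨A, hAne, hAq, hA⟩
    have : Nonempty B := hB.to_subtype
    obtain ⟨emb⟩ : Nonempty (B ↪ Fin q) := Function.Embedding.nonempty_of_card_le (by simpa using hBq)
    -- A left inverse of an embedding into `Fin q` lists the generators with repetitions, as a tuple
    -- of length exactly `q`.
    refine ⟨fun i => (Function.invFun emb i).1, ?_⟩
    rw [hBK]
    ext v
    simp only [Set.mem_iInter]
    refine ⟨fun hv b hb => ?_, fun hv i => hv _ (Function.invFun emb i).2⟩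
    obtain ⟨i, hi⟩ := Function.invFun_surjective emb.injective ⟨b, hb⟩
    have := hv i
    rwa [hi] at this
  refine (Set.ncard_le_ncard hsub (Set.toFinite _)).trans ?_
  rw [← Set.image_univ]
  refine (Set.ncard_image_le Set.finite_univ).trans ?_
  rw [Set.ncard_univ, Nat.card_fun, Nat.card_fin]
  rfl

end FinGraph

/-! ### Reasoning about programs -/

namespace Ram

/-- `P`, started in `σ`, halts after at most `T` steps in a state satisfying `Q`. -/
def Does (P : Prog) (σ : State) (T : ℕ) (Q : State → Prop) : Prop :=
  ∃ t τ, Runs P σ t τ ∧ t ≤ T ∧ Q τ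

/-- Straight-line programs. -/
def block : List Instr → Prog
  | [] => .skip
  | i :: l => .seq (.instr i) (block l)

/-- The effect of a straight-line program. -/
def exec : List Instr → State → State
  | [], σ => σ
  | i :: l, σ => exec l (i.apply σ)

lemma runs_block (l : List Instr) (σ : State) : Runs (block l) σ l.length (exec l σ) := by
  induction l generalizing σ with
  | nil => exact Runs.skip σ
  | cons i l ih =>
    rw [List.length_cons, add_comm]
    exact Runs.seq (Runs.instr i σ) (ih _)

lemma Does.mono {P : Prog} {σ : State} {T T' : ℕ} {Q Q' : State → Prop} (h : Does P σ T Q)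
    (hT : T ≤ T') (hQ : ∀ τ, Q τ → Q' τ) : Does P σ T' Q' := by
  obtain ⟨t, τ, hr, ht, hq⟩ := h
  exact ⟨t, τ, hr, ht.trans hT, hQ τ hq⟩

lemma does_block {l : List Instr} {σ : State} {T : ℕ} {Q : State → Prop} (hT : l.length ≤ T)
    (h : Q (exec l σ)) : Does (block l) σ T Q :=
  ⟨_, _, runs_block l σ, hT, h⟩

lemma Does.seq {P P' : Prog} {σ : State} {T T' : ℕ} {Q Q' : State → Prop} (h : Does P σ T Q)
    (h' : ∀ τ, Q τ → Does P' τ T' Q') : Does (.seq P P') σ (T + T') Q' := by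
  obtain ⟨t, τ, hr, ht, hq⟩ := h
  obtain ⟨t', υ, hr', ht', hq'⟩ := h' τ hq
  exact ⟨_, υ, hr.seq hr', Nat.add_le_add ht ht', hq'⟩

lemma Does.block_seq {l : List Instr} {P : Prog} {σ : State} {T : ℕ} {Q : State → Prop}
    (h : Does P (exec l σ) T Q) : Does (.seq (block l) P) σ (l.length + T) Q :=
  (does_block (Q := fun τ => τ = exec l σ) le_rfl rfl).seq (fun _ hτ => hτ ▸ h)

lemma does_while_of_eq_zero {r : ℕ} {P : Prog} {σ : State} {T : ℕ} {Q : State → Prop}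
    (hr : σ.reg r = 0) (hT : 1 ≤ T) (h : Q σ) : Does (.while r P) σ T Q :=
  ⟨_, _, Runs.while_false hr, hT, h⟩

lemma Does.while_step {r : ℕ} {P : Prog} {σ : State} {T T' : ℕ} {Q Q' : State → Prop}
    (hr : σ.reg r ≠ 0) (h : Does P σ T Q) (h' : ∀ τ, Q τ → Does (.while r P) τ T' Q') :
    Does (.while r P) σ (T + T' + 1) Q' := by
  obtain ⟨t, τ, hr₁, ht, hq⟩ := h
  obtain ⟨t', υ, hr₂, ht', hq'⟩ := h' τ hq
  exact ⟨_, υ, Runs.while_true hr hr₁ hr₂, by omega, hq'⟩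

lemma Does.while_block_step {r : ℕ} {l : List Instr} {σ : State} {T : ℕ} {Q : State → Prop}
    (hr : σ.reg r ≠ 0) (h : Does (.while r (block l)) (exec l σ) T Q) :
    Does (.while r (block l)) σ (l.length + T + 1) Q :=
  Does.while_step hr (does_block (Q := fun τ => τ = exec l σ) le_rfl rfl) (fun _ hτ => hτ ▸ h)

/-- Only the registers in the list `S` change. -/
def Upd (S : List ℕ) (σ τ : State) : Prop := ∀ r, r ∉ S → τ.reg r = σ.reg r

lemma Upd.refl (S : List ℕ) (σ : State) : Upd S σ σ := fun _ _ => rfl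

lemma Upd.mono {S U : List ℕ} {σ τ : State} (h : Upd S σ τ) (hS : S ⊆ U) : Upd U σ τ :=
  fun r hr => h r (fun hr' => hr (hS hr'))

lemma Upd.trans {S S' U : List ℕ} {σ τ υ : State} (h : Upd S σ τ) (h' : Upd S' τ υ)
    (hS : S ⊆ U) (hS' : S' ⊆ U) : Upd U σ υ := fun r hr =>
  (h' r (fun hr' => hr (hS' hr'))).trans (h r (fun hr' => hr (hS hr')))

/-! ### The clique filter -/

/-- Adds to register `5` a positive number unless array `2` is dominated by the segment of
array `0` that starts at register `15`. -/
def subsetLoop : Prog :=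
  .while 6 (block [.sub 6 6 2, .load 9 2 6, .add 7 15 6, .load 10 0 7, .sub 11 9 10, .add 5 5 11])

/-- A truncated difference vanishes exactly when the inequality holds, and register `5` accumulates
the violations. Throughout, register `2` is the constant one and register `8` the constant zero, so
adding register `8` copies. Array `2` holds the candidate set. -/
lemma does_subsetLoop (k : ℕ) (σ : State) (h6 : σ.reg 6 = k) (h2 : σ.reg 2 = 1) :
    Does subsetLoop σ (7 * k + 1) (fun τ => τ.arr = σ.arr ∧ Upd [5, 6, 7, 9, 10, 11] σ τ ∧
      (τ.reg 5 = 0 ↔ σ.reg 5 = 0 ∧ ∀ y < k, σ.arr 2 y ≤ σ.arr 0 (σ.reg 15 + y))) := by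
  induction k generalizing σ with
  | zero => exact does_while_of_eq_zero h6 (by omega) ⟨rfl, Upd.refl _ _, by simp⟩
  | succ k ih =>
    refine (Does.while_block_step (by omega) (ih _ ?_ ?_)).mono (by simp; omega) ?_
    · simp [exec, Instr.apply, h6, h2]
    · simp [exec, Instr.apply, h2]
    · rintro τ ⟨harr, hupd, h5⟩
      refine ⟨harr.trans rfl, fun r hr => ?_, h5.trans ?_⟩
      · rw [hupd r hr]
        simp at hr
        simp [exec, Instr.apply, hr]
      · rw [Nat.forall_lt_succ_right]
        simp [exec, Instr.apply, h6, h2]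
        grind

/-- Adds to register `17` a positive number unless array `2` equals the segment of array `1`
that starts at register `16`. -/
def compareLoop : Prog :=
  .while 6 (block [.sub 6 6 2, .load 9 2 6, .add 7 16 6, .load 10 1 7, .sub 11 9 10,
    .add 17 17 11, .sub 11 10 9, .add 17 17 11])

lemma does_compareLoop (k : ℕ) (σ : State) (h6 : σ.reg 6 = k) (h2 : σ.reg 2 = 1) :
    Does compareLoop σ (9 * k + 1) (fun τ => τ.arr = σ.arr ∧ Upd [6, 7, 9, 10, 11, 17] σ τ ∧
      (τ.reg 17 = 0 ↔ σ.reg 17 = 0 ∧ ∀ y < k, σ.arr 2 y = σ.arr 1 (σ.reg 16 + y))) := by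
  induction k generalizing σ with
  | zero => exact does_while_of_eq_zero h6 (by omega) ⟨rfl, Upd.refl _ _, by simp⟩
  | succ k ih =>
    refine (Does.while_block_step (by omega) (ih _ ?_ ?_)).mono (by simp; omega) ?_
    · simp [exec, Instr.apply, h6, h2]
    · simp [exec, Instr.apply, h2]
    · rintro τ ⟨harr, hupd, h5⟩
      refine ⟨harr.trans rfl, fun r hr => ?_, h5.trans ?_⟩
      · rw [hupd r hr]
        simp at hr
        simp [exec, Instr.apply, hr]
      · rw [Nat.forall_lt_succ_right]
        simp [exec, Instr.apply, h6, h2]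
        grind

/-- Copies array `2` to the segment of array `1` that starts at register `16`. -/
def copyLoop : Prog :=
  .while 6 (block [.sub 6 6 2, .load 9 2 6, .add 7 16 6, .store 1 7 9])

lemma does_copyLoop (k : ℕ) (σ : State) (h6 : σ.reg 6 = k) (h2 : σ.reg 2 = 1) :
    Does copyLoop σ (5 * k + 1) (fun τ => Upd [6, 7, 9] σ τ ∧ (∀ a, a ≠ 1 → τ.arr a = σ.arr a) ∧
      (∀ y < k, τ.arr 1 (σ.reg 16 + y) = σ.arr 2 y) ∧
      ∀ x, (x < σ.reg 16 ∨ σ.reg 16 + k ≤ x) → τ.arr 1 x = σ.arr 1 x) := by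
  induction k generalizing σ with
  | zero =>
    exact does_while_of_eq_zero h6 (by omega) ⟨Upd.refl _ _, fun _ _ => rfl, by simp, by simp⟩
  | succ k ih =>
    refine (Does.while_block_step (by omega) (ih _ ?_ ?_)).mono (by simp; omega) ?_
    · simp [exec, Instr.apply, h6, h2]
    · simp [exec, Instr.apply, h2]
    · rintro τ ⟨hupd, harr, hc, ho⟩
      have h16 : (exec [.sub 6 6 2, .load 9 2 6, .add 7 16 6, .store 1 7 9] σ).reg 16
          = σ.reg 16 := by simp [exec, Instr.apply]
      rw [h16] at hc ho
      refine ⟨fun r hr => ?_, fun a ha => ?_, fun y hy => ?_, fun x hx => ?_⟩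
      · rw [hupd r hr]
        simp at hr
        simp [exec, Instr.apply, hr]
      · rw [harr a ha]
        simp [exec, Instr.apply, ha]
      · rcases Nat.lt_succ_iff_lt_or_eq.mp hy with hy | rfl
        · rw [hc y hy]
          simp [exec, Instr.apply]
        · rw [ho _ (Or.inr le_rfl)]
          simp [exec, Instr.apply, h6, h2]
      · rw [ho x (by omega)]
        have : x ≠ σ.reg 16 + k := by omega
        simp [exec, Instr.apply, h6, h2, this]

end Ram

/-! ### Testing a candidate set and appending it to the list -/

namespace Ram

open Classical in
/-- The truth value of a proposition as a number. -/
noncomputable def ind (p : Prop) : ℕ := if p then 1 else 0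

lemma ind_of {p : Prop} (h : p) : ind p = 1 := if_pos h

lemma ind_of_not {p : Prop} (h : ¬ p) : ind p = 0 := if_neg h

lemma ind_eq_one {p : Prop} : ind p = 1 ↔ p := by
  by_cases h : p <;> simp [ind, h]

lemma ind_le_one (p : Prop) : ind p ≤ 1 := by
  by_cases h : p <;> simp [ind, h]

lemma ind_le_ind {p q : Prop} : ind p ≤ ind q ↔ (p → q) := by
  by_cases hp : p <;> by_cases hq : q <;> simp [ind, hp, hq]

lemma ind_inj {p q : Prop} : ind p = ind q ↔ (p ↔ q) := by
  by_cases hp : p <;> by_cases hq : q <;> simp [ind, hp, hq]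

/-- Adds to register `3` a positive number unless array `2` is the intersection of the rows of
array `0` that belong to its members. -/
def checkLoop : Prog :=
  .while 4 (.seq (block [.sub 4 4 2, .const 5 0, .add 6 0 8]) (.seq subsetLoop
    (block [.load 9 2 14, .sub 13 2 5, .sub 11 9 13, .sub 12 13 9, .add 3 3 11, .add 3 3 12,
      .add 14 14 2, .add 15 15 0])))

lemma does_checkLoop (n k : ℕ) (σ : State) (h4 : σ.reg 4 = k) (h0 : σ.reg 0 = n)
    (h2 : σ.reg 2 = 1) (h8 : σ.reg 8 = 0) :
    Does checkLoop σ ((7 * n + 13) * k + 1) (fun τ => τ.arr = σ.arr ∧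
      Upd [3, 4, 5, 6, 7, 9, 10, 11, 12, 13, 14, 15] σ τ ∧
      (τ.reg 3 = 0 ↔ σ.reg 3 = 0 ∧ ∀ j < k, σ.arr 2 (σ.reg 14 + j) =
        ind (∀ y < n, σ.arr 2 y ≤ σ.arr 0 (σ.reg 15 + j * n + y)))) := by
  induction k generalizing σ with
  | zero => exact does_while_of_eq_zero h4 (by omega) ⟨rfl, Upd.refl _ _, by simp⟩
  | succ k ih =>
    refine (Does.while_step (by omega)
      (Does.block_seq ((does_subsetLoop n _ ?_ ?_).seq fun τ hτ =>
        does_block (Q := fun υ => υ.arr = σ.arr ∧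
          Upd [3, 4, 5, 6, 7, 9, 10, 11, 12, 13, 14, 15] σ υ ∧ υ.reg 4 = k ∧
          υ.reg 14 = σ.reg 14 + 1 ∧ υ.reg 15 = σ.reg 15 + n ∧
          (υ.reg 3 = 0 ↔ σ.reg 3 = 0 ∧ σ.arr 2 (σ.reg 14) =
            ind (∀ y < n, σ.arr 2 y ≤ σ.arr 0 (σ.reg 15 + y)))) le_rfl ?_)) (fun υ hυ => ?_)).mono
      (T := 3 + (7 * n + 1 + 8) + ((7 * n + 13) * k + 1) + 1) ?_ (fun _ h => h)
    · simp [exec, Instr.apply, h0, h8]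
    · simp [exec, Instr.apply, h2]
    · obtain ⟨harr, hupd, h5⟩ := hτ
      have harr' : τ.arr = σ.arr := harr.trans rfl
      have hu : Upd [4, 5, 6, 7, 9, 10, 11] σ τ := by
        refine Upd.trans (S := [4, 5, 6]) (fun r hr => ?_) hupd (by decide) (by decide)
        simp at hr
        simp [exec, Instr.apply, hr]
      have t3 := hu 3 (by decide)
      have t2 := hu 2 (by decide)
      have t14 := hu 14 (by decide)
      have t15 := hu 15 (by decide)
      have t0 := hu 0 (by decide)
      have t4 : τ.reg 4 = k := by
        rw [hupd 4 (by decide)]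
        simp [exec, Instr.apply, h4, h2]
      simp [exec, Instr.apply] at h5
      refine ⟨harr', fun r hr => ?_, ?_, ?_, ?_, ?_⟩
      · rw [← hu.mono (by decide) r hr]
        simp at hr
        simp [exec, Instr.apply, hr]
      · simp [exec, Instr.apply, t4]
      · simp [exec, Instr.apply, t14, t2, h2]
      · simp [exec, Instr.apply, t15, t0, h0]
      · simp [exec, Instr.apply, t3, t14, t2, h2, harr']
        -- The register `13` holds the truth value of domination; the two truncated differences with
        -- the candidate's entry both vanish exactly when the values agree.
        by_cases hsub : ∀ y < n, σ.arr 2 y ≤ σ.arr 0 (σ.reg 15 + y)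
        · rw [ind_of hsub, h5.mpr hsub]
          omega
        · have := mt h5.mp hsub
          rw [ind_of_not hsub]
          omega
    · obtain ⟨harr, hupd, h4', h14, h15, h3⟩ := hυ
      refine (ih υ h4' ((hupd 0 (by decide)).trans h0) ((hupd 2 (by decide)).trans h2)
        ((hupd 8 (by decide)).trans h8)).mono le_rfl ?_
      rintro ω ⟨harr₁, hupd₁, h3₁⟩
      refine ⟨harr₁.trans harr, hupd.trans hupd₁ (by decide) (by decide), ?_⟩
      rw [h3₁, h3, harr, h14, h15, Nat.forall_lt_succ_left, and_assoc]
      have e : ∀ j y, σ.reg 15 + n + j * n + y = σ.reg 15 + (j + 1) * n + y := fun j y => by ring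
      have e' : ∀ j, σ.reg 14 + 1 + j = σ.reg 14 + (j + 1) := fun j => by ring
      simp only [e, e', zero_mul, add_zero]
    · rw [Nat.mul_succ]
      omega

/-- Adds to register `3` a positive number if array `2` equals one of the rows of array `1`. -/
def duplicateLoop : Prog :=
  .while 4 (.seq (block [.sub 4 4 2, .const 17 0, .add 6 0 8]) (.seq compareLoop
    (block [.sub 11 2 17, .add 3 3 11, .add 16 16 0])))

lemma does_duplicateLoop (n k : ℕ) (σ : State) (h4 : σ.reg 4 = k) (h0 : σ.reg 0 = n)
    (h2 : σ.reg 2 = 1) (h8 : σ.reg 8 = 0) :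
    Does duplicateLoop σ ((9 * n + 8) * k + 1) (fun τ => τ.arr = σ.arr ∧
      Upd [3, 4, 6, 7, 9, 10, 11, 16, 17] σ τ ∧ τ.reg 16 = σ.reg 16 + k * n ∧
      (τ.reg 3 = 0 ↔ σ.reg 3 = 0 ∧ ∀ j < k,
        ¬ ∀ y < n, σ.arr 2 y = σ.arr 1 (σ.reg 16 + j * n + y))) := by
  induction k generalizing σ with
  | zero => exact does_while_of_eq_zero h4 (by omega) ⟨rfl, Upd.refl _ _, by simp, by simp⟩
  | succ k ih =>
    refine (Does.while_step (by omega)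
      (Does.block_seq ((does_compareLoop n _ ?_ ?_).seq fun τ hτ =>
        does_block (Q := fun υ => υ.arr = σ.arr ∧
          Upd [3, 4, 6, 7, 9, 10, 11, 16, 17] σ υ ∧ υ.reg 4 = k ∧
          υ.reg 16 = σ.reg 16 + n ∧
          (υ.reg 3 = 0 ↔ σ.reg 3 = 0 ∧ ¬ ∀ y < n, σ.arr 2 y = σ.arr 1 (σ.reg 16 + y)))
            le_rfl ?_)) (fun υ hυ => ?_)).mono
      (T := 3 + (9 * n + 1 + 3) + ((9 * n + 8) * k + 1) + 1) ?_ (fun _ h => h)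
    · simp [exec, Instr.apply, h0, h8]
    · simp [exec, Instr.apply, h2]
    · obtain ⟨harr, hupd, h5⟩ := hτ
      have harr' : τ.arr = σ.arr := harr.trans rfl
      have hu : Upd [4, 6, 7, 9, 10, 11, 17] σ τ := by
        refine Upd.trans (S := [4, 6, 17]) (fun r hr => ?_) hupd (by decide) (by decide)
        simp at hr
        simp [exec, Instr.apply, hr]
      have t3 := hu 3 (by decide)
      have t2 := hu 2 (by decide)
      have t16 := hu 16 (by decide)
      have t0 := hu 0 (by decide)
      have t4 : τ.reg 4 = k := by
        rw [hupd 4 (by decide)]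
        simp [exec, Instr.apply, h4, h2]
      simp [exec, Instr.apply] at h5
      refine ⟨harr', fun r hr => ?_, ?_, ?_, ?_⟩
      · rw [← hu.mono (by decide) r hr]
        simp at hr
        simp [exec, Instr.apply, hr]
      · simp [exec, Instr.apply, t4]
      · simp [exec, Instr.apply, t16, t0, h0]
      · rw [← h5]
        simp [exec, Instr.apply, t3, t2, h2]
        omega
    · obtain ⟨harr, hupd, h4', h16, h3⟩ := hυ
      refine (ih υ h4' ((hupd 0 (by decide)).trans h0) ((hupd 2 (by decide)).trans h2)
        ((hupd 8 (by decide)).trans h8)).mono le_rfl ?_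
      rintro ω ⟨harr₁, hupd₁, h16₁, h3₁⟩
      refine ⟨harr₁.trans harr, hupd.trans hupd₁ (by decide) (by decide), ?_, ?_⟩
      · rw [h16₁, h16]
        ring
      rw [h3₁, h3, harr, h16, Nat.forall_lt_succ_left, and_assoc]
      have e : ∀ j y, σ.reg 16 + n + j * n + y = σ.reg 16 + (j + 1) * n + y := fun j y => by ring
      simp only [e, zero_mul, add_zero]
    · rw [Nat.mul_succ]
      omega

/-- Appends array `2` to the list in array `1` if it describes a maximal clique that has not been
listed yet. -/
def filterProg : Prog :=
  .seq (block [.const 3 0, .add 4 0 8, .const 14 0, .const 15 0]) (.seq checkLoop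
    (.seq (block [.add 4 1 8, .const 16 0]) (.seq duplicateLoop
      (.seq (block [.add 6 0 8]) (.seq copyLoop (block [.sub 11 2 3, .add 1 1 11]))))))

/-- The candidate is always copied to the first free row of array `1`, but the counter grows only if
register `3` stayed zero, so a rejected candidate is overwritten later. The duplicate test leaves
register `16` at the start of that row, which replaces a multiplication. -/
lemma does_filterProg (n : ℕ) (σ : State) (h0 : σ.reg 0 = n) (h2 : σ.reg 2 = 1)
    (h8 : σ.reg 8 = 0) :
    Does filterProg σ ((7 * n + 13) * n + (9 * n + 8) * σ.reg 1 + 5 * n + 12) (fun τ =>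
      Upd [1, 3, 4, 5, 6, 7, 9, 10, 11, 12, 13, 14, 15, 16, 17] σ τ ∧
      (∀ a, a ≠ 1 → τ.arr a = σ.arr a) ∧
      (∀ y < n, τ.arr 1 (σ.reg 1 * n + y) = σ.arr 2 y) ∧
      (∀ x < σ.reg 1 * n, τ.arr 1 x = σ.arr 1 x) ∧
      τ.reg 1 = σ.reg 1 + ind (
        (∀ j < n, σ.arr 2 j = ind (∀ y < n, σ.arr 2 y ≤ σ.arr 0 (j * n + y))) ∧
        ∀ j < σ.reg 1, ¬ ∀ y < n, σ.arr 2 y = σ.arr 1 (j * n + y))) := by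
  refine (Does.block_seq ((does_checkLoop n n _ ?_ ?_ ?_ ?_).seq fun τ hτ => Does.block_seq
    ((does_duplicateLoop n (σ.reg 1) _ ?_ ?_ ?_ ?_).seq fun υ hυ => Does.block_seq
      ((does_copyLoop n _ ?_ ?_).seq fun ω hω => does_block le_rfl ?_)))).mono
        (T' := (7 * n + 13) * n + (9 * n + 8) * σ.reg 1 + 5 * n + 12) ?_ (fun _ h => h)
  · simp [exec, Instr.apply, h0, h8]
  · simp [exec, Instr.apply, h0]
  · simp [exec, Instr.apply, h2]
  · simp [exec, Instr.apply, h8]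
  all_goals try
    obtain ⟨harr, hupd, h3⟩ := hτ
    have harr' : τ.arr = σ.arr := harr.trans rfl
    have hu : Upd [3, 4, 5, 6, 7, 9, 10, 11, 12, 13, 14, 15] σ τ := by
      refine Upd.trans (S := [3, 4, 14, 15]) (fun r hr => ?_) hupd (by decide) (by decide)
      simp at hr
      simp [exec, Instr.apply, hr]
    have t1 := hu 1 (by decide)
    have t2 := hu 2 (by decide)
    have t0 := hu 0 (by decide)
    have t8 := hu 8 (by decide)
    simp [exec, Instr.apply] at h3
  · simp [exec, Instr.apply, t1, t8, h8]
  · simp [exec, Instr.apply, t0, h0]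
  · simp [exec, Instr.apply, t2, h2]
  · simp [exec, Instr.apply, t8, h8]
  all_goals try
    obtain ⟨harr₁, hupd₁, h16, h3₁⟩ := hυ
    have harr₁' : υ.arr = σ.arr := harr₁.trans harr'
    have hu₁ : Upd [3, 4, 5, 6, 7, 9, 10, 11, 12, 13, 14, 15, 16, 17] σ υ := by
      refine hu.trans (Upd.trans (S := [4, 16])
        (U := [3, 4, 6, 7, 9, 10, 11, 16, 17]) (fun r hr => ?_) hupd₁ (by decide) (by decide))
        (by decide) (by decide)
      simp at hr
      simp [exec, Instr.apply, hr]
    have u1 := hu₁ 1 (by decide)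
    have u2 := hu₁ 2 (by decide)
    have u0 := hu₁ 0 (by decide)
    have u8 := hu₁ 8 (by decide)
    simp [exec, Instr.apply, harr'] at h3₁ h16
  · simp [exec, Instr.apply, u0, u8, h0, h8]
  · simp [exec, Instr.apply, u2, h2]
  · obtain ⟨hupd₂, harr₂, hc, ho⟩ := hω
    simp [exec, Instr.apply, harr₁', h16] at hc ho
    have hu₂ : Upd [3, 4, 5, 6, 7, 9, 10, 11, 12, 13, 14, 15, 16, 17] σ ω := by
      refine hu₁.trans (Upd.trans (S := [6]) (U := [6, 7, 9]) (fun r hr => ?_) hupd₂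
        (by decide) (by decide)) (by decide) (by decide)
      simp at hr
      simp [exec, Instr.apply, hr]
    have w1 := hu₂ 1 (by decide)
    have w2 := hu₂ 2 (by decide)
    have w3 : ω.reg 3 = υ.reg 3 := by
      rw [hupd₂ 3 (by decide)]
      simp [exec, Instr.apply]
    refine ⟨fun r hr => ?_, fun a ha => ?_, ?_, ?_, ?_⟩
    · rw [← hu₂.mono (by decide) r hr]
      simp at hr
      simp [exec, Instr.apply, hr]
    · refine (harr₂ a ha).trans ?_
      simp [exec, Instr.apply, harr₁']
    · simpa [exec, Instr.apply] using hc
    · intro x hx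
      simpa [exec, Instr.apply] using ho x (Or.inl hx)
    · simp only [exec, Instr.apply]
      simp [w1, w2, w3, h2]
      rw [← h3, ← h3₁]
      by_cases h : υ.reg 3 = 0
      · rw [ind_of h, h]
      · rw [ind_of_not h]
        omega
  · simp
    omega

end Ram

namespace Ram

/-! ### Enumerating the intersections of rows -/

/-- The constants and the matrix `N`, with rows `0, …, n`, are in place. -/
structure Ready (n : ℕ) (N : ℕ → ℕ → Prop) (σ : State) : Prop where
  size : σ.reg 0 = n
  one : σ.reg 2 = 1
  zero : σ.reg 8 = 0
  matrix : ∀ i ≤ n, ∀ x < n, σ.arr 0 (i * n + x) = ind (N i x)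

/-- Array `a` holds the characteristic vector of `Z`. -/
def IsRow (n a : ℕ) (Z : Set ℕ) (σ : State) : Prop := ∀ x < n, σ.arr a x = ind (x ∈ Z)

/-- The `i`-th set listed in array `1`. -/
def rowSet (n : ℕ) (σ : State) (i : ℕ) : Set ℕ := {x | x < n ∧ σ.arr 1 (i * n + x) = 1}

/-- The family `F` is listed without repetition. -/
def Listed (n : ℕ) (F : Set (Set ℕ)) (σ : State) : Prop :=
  (∀ x < σ.reg 1 * n, σ.arr 1 x ≤ 1) ∧ Set.BijOn (rowSet n σ) (Set.Iio (σ.reg 1)) F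

/-- The sets that equal the intersection of the rows of their members. -/
def closedSets (n : ℕ) (N : ℕ → ℕ → Prop) : Set (Set ℕ) :=
  {K | K ⊆ Set.Iio n ∧ ∀ j < n, (j ∈ K ↔ ∀ y < n, y ∈ K → N j y)}

/-- The memory that the enumeration of depth `k` leaves unchanged. -/
def Frame (k : ℕ) (σ τ : State) : Prop :=
  (∀ r, r = 0 ∨ r = 2 ∨ r = 8 ∨ 20 + 2 * k ≤ r → τ.reg r = σ.reg r) ∧
    ∀ a, a = 0 ∨ 2 + k ≤ a → τ.arr a = σ.arr a

lemma Frame.trans {k l : ℕ} {σ τ υ : State} (h : Frame k σ τ) (h' : Frame l τ υ) (hkl : l ≤ k) :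
    Frame k σ υ :=
  ⟨fun r hr => (h'.1 r (by omega)).trans (h.1 r hr),
    fun a ha => (h'.2 a (by omega)).trans (h.2 a ha)⟩

lemma Ready.of_frame {n k : ℕ} {N : ℕ → ℕ → Prop} {σ τ : State} (h : Ready n N σ)
    (hf : Frame k σ τ) : Ready n N τ :=
  ⟨(hf.1 0 (by simp)).trans h.size, (hf.1 2 (by simp)).trans h.one,
    (hf.1 8 (by simp)).trans h.zero, fun i hi x hx => by
      rw [hf.2 0 (by simp)]
      exact h.matrix i hi x hx⟩

lemma Listed.congr {n : ℕ} {F : Set (Set ℕ)} {σ τ : State} (h : Listed n F σ)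
    (h1 : τ.reg 1 = σ.reg 1) (harr : τ.arr 1 = σ.arr 1) : Listed n F τ := by
  have : rowSet n τ = rowSet n σ := by
    funext i
    simp only [rowSet, harr]
  unfold Listed
  rw [h1, harr, this]
  exact h

/-- The list is free of repetitions and contains only closed sets, so its length, on which the cost
of the duplicate test depends, never exceeds `B`. -/
lemma Listed.reg_le {n B : ℕ} {N : ℕ → ℕ → Prop} {F : Set (Set ℕ)} {σ : State}
    (h : Listed n F σ) (hF : F ⊆ closedSets n N) (hB : (closedSets n N).ncard ≤ B) :
    σ.reg 1 ≤ B := by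
  have hfin : (closedSets n N).Finite :=
    (Set.finite_Iio n).finite_subsets.subset fun K hK => hK.1
  have : F.ncard = σ.reg 1 := by
    rw [← h.2.image_eq, h.2.injOn.ncard_image]
    simp [Set.ncard_eq_toFinset_card']
  rw [← this]
  exact (Set.ncard_le_ncard hF hfin).trans hB

lemma eq_rowSet_iff {n : ℕ} {Z : Set ℕ} (hZ : Z ⊆ Set.Iio n) {σ : State} (h : IsRow n 2 Z σ)
    {j : ℕ} (hj : j < σ.reg 1) (h1 : ∀ x < σ.reg 1 * n, σ.arr 1 x ≤ 1) :
    (∀ y < n, σ.arr 2 y = σ.arr 1 (j * n + y)) ↔ rowSet n σ j = Z := by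
  have hlt : ∀ y < n, σ.arr 1 (j * n + y) ≤ 1 := fun y hy => h1 _ (by
    have := Nat.mul_le_mul_right n (Nat.succ_le_of_lt hj)
    rw [Nat.succ_mul] at this
    omega)
  constructor
  · intro heq
    ext y
    constructor
    · rintro ⟨hy, hy1⟩
      rwa [← heq y hy, h y hy, ind_eq_one] at hy1
    · intro hy
      refine ⟨hZ hy, ?_⟩
      rw [← heq y (hZ hy), h y (hZ hy), ind_of hy]
  · rintro heq y hy
    rw [h y hy]
    by_cases hyZ : y ∈ Z
    · rw [ind_of hyZ]
      rw [← heq] at hyZ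
      exact hyZ.2.symm
    · rw [ind_of_not hyZ]
      have : σ.arr 1 (j * n + y) ≠ 1 := fun h => hyZ (heq ▸ ⟨hy, h⟩)
      have := hlt y hy
      omega

lemma does_filter {n : ℕ} {N : ℕ → ℕ → Prop} {σ : State} {Z : Set ℕ} {F : Set (Set ℕ)}
    (hσ : Ready n N σ) (hZ : Z ⊆ Set.Iio n) (hrow : IsRow n 2 Z σ) (hF : Listed n F σ) :
    Does filterProg σ ((7 * n + 13) * n + (9 * n + 8) * σ.reg 1 + 5 * n + 12) (fun τ =>
      Frame 0 σ τ ∧ Listed n (F ∪ {K | K = Z ∧ K ∈ closedSets n N}) τ) := by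
  refine (does_filterProg n σ hσ.size hσ.one hσ.zero).mono le_rfl ?_
  rintro τ ⟨hupd, harr, hnew, hold, h1⟩
  refine ⟨⟨fun r hr => hupd r ?_, fun a ha => harr a (by omega)⟩, ?_⟩
  · simp
    omega
  have hclosed : (∀ j < n, σ.arr 2 j = ind (∀ y < n, σ.arr 2 y ≤ σ.arr 0 (j * n + y))) ↔
      Z ∈ closedSets n N := by
    simp only [closedSets, Set.mem_ofPred_eq, hZ, true_and]
    refine forall₂_congr fun j hj => ?_
    rw [hrow j hj, ind_inj]
    refine iff_congr Iff.rfl (forall₂_congr fun y hy => ?_)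
    rw [hrow y hy, hσ.matrix j hj.le y hy, ind_le_ind]
  have hnewF : (∀ j < σ.reg 1, ¬ ∀ y < n, σ.arr 2 y = σ.arr 1 (j * n + y)) ↔ Z ∉ F := by
    rw [← hF.2.image_eq]
    simp only [Set.mem_image, Set.mem_Iio, not_exists, not_and]
    exact forall₂_congr fun j hj => not_congr (eq_rowSet_iff hZ hrow hj hF.1)
  rw [hclosed, hnewF] at h1
  have hsame : ∀ j < σ.reg 1, rowSet n τ j = rowSet n σ j := by
    intro j hj
    ext y
    simp only [rowSet, Set.mem_ofPred_eq]
    refine and_congr_right fun hy => ?_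
    rw [hold]
    have := Nat.mul_le_mul_right n (Nat.succ_le_of_lt hj)
    rw [Nat.succ_mul] at this
    omega
  have hbij : Set.BijOn (rowSet n τ) (Set.Iio (σ.reg 1)) F :=
    hF.2.congr fun j hj => (hsame j hj).symm
  have hone : ∀ x < σ.reg 1 * n, τ.arr 1 x ≤ 1 := fun x hx => (hold x hx).trans_le (hF.1 x hx)
  by_cases hc : Z ∈ closedSets n N ∧ Z ∉ F
  · rw [ind_of hc] at h1
    have hlast : rowSet n τ (σ.reg 1) = Z := by
      ext y
      simp only [rowSet, Set.mem_ofPred_eq]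
      constructor
      · rintro ⟨hy, h⟩
        rwa [hnew y hy, hrow y hy, ind_eq_one] at h
      · intro hy
        refine ⟨hZ hy, ?_⟩
        rw [hnew y (hZ hy), hrow y (hZ hy), ind_of hy]
    have hset : F ∪ {K | K = Z ∧ K ∈ closedSets n N} = insert Z F := by
      ext K
      simp only [Set.mem_union, Set.mem_ofPred_eq, Set.mem_insert_iff]
      constructor
      · rintro (h | h)
        · exact Or.inr h
        · exact Or.inl h.1
      · rintro (rfl | h)
        · exact Or.inr ⟨rfl, hc.1⟩
        · exact Or.inl h
    have hIio : Set.Iio (σ.reg 1 + 1) = insert (σ.reg 1) (Set.Iio (σ.reg 1)) := by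
      ext x
      simp only [Set.mem_Iio, Set.mem_insert_iff]
      omega
    refine ⟨fun x hx => ?_, ?_⟩
    · rw [h1, Nat.succ_mul] at hx
      by_cases hx' : x < σ.reg 1 * n
      · exact hone x hx'
      · obtain ⟨y, rfl⟩ := Nat.exists_eq_add_of_le (not_lt.mp hx')
        rw [hnew y (by omega), hrow y (by omega)]
        exact ind_le_one _
    · rw [h1, hset, hIio, ← hlast]
      exact hbij.insert (by rw [hlast]; exact hc.2)
  · rw [ind_of_not hc, add_zero] at h1
    have hset : F ∪ {K | K = Z ∧ K ∈ closedSets n N} = F := by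
      refine Set.union_eq_left.mpr ?_
      rintro K ⟨rfl, hK⟩
      by_contra hKF
      exact hc ⟨hK, hKF⟩
    rw [hset]
    refine ⟨?_, ?_⟩ <;> rw [h1]
    · exact hone
    · exact hbij

/-- Stores in array `2 + k` the intersection of array `3 + k` with the row of array `0` that starts
at register `21 + 2 * k`. -/
def interLoop (k : ℕ) : Prog :=
  .while 6 (block [.sub 6 6 2, .load 9 (3 + k) 6, .add 7 (21 + 2 * k) 6, .load 10 0 7,
    .add 11 9 10, .sub 11 11 2, .store (2 + k) 6 11])

/-- On values zero and one, the sum minus one, truncated, is conjunction. -/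
lemma does_interLoop (k c : ℕ) (σ : State) (h6 : σ.reg 6 = c) (h2 : σ.reg 2 = 1) :
    Does (interLoop k) σ (8 * c + 1) (fun τ => Upd [6, 7, 9, 10, 11] σ τ ∧
      (∀ a, a ≠ 2 + k → τ.arr a = σ.arr a) ∧
      (∀ y < c, τ.arr (2 + k) y = σ.arr (3 + k) y + σ.arr 0 (σ.reg (21 + 2 * k) + y) - 1) ∧
      ∀ y, c ≤ y → τ.arr (2 + k) y = σ.arr (2 + k) y) := by
  induction c generalizing σ with
  | zero =>
    exact does_while_of_eq_zero h6 (by omega) ⟨Upd.refl _ _, fun _ _ => rfl, by simp, by simp⟩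
  | succ c ih =>
    have e1 : 21 + 2 * k ≠ 6 := by omega
    have e2 : 21 + 2 * k ≠ 7 := by omega
    have e3 : 21 + 2 * k ≠ 9 := by omega
    have e4 : 21 + 2 * k ≠ 10 := by omega
    have e5 : 21 + 2 * k ≠ 11 := by omega
    have e7 : 0 ≠ 2 + k := by omega
    refine (Does.while_block_step (by omega) (ih _ ?_ ?_)).mono (by simp; omega) ?_
    · simp [exec, Instr.apply, h6, h2]
    · simp [exec, Instr.apply, h2]
    · rintro τ ⟨hupd, harr, hc, ho⟩
      refine ⟨fun r hr => ?_, fun a ha => ?_, fun y hy => ?_, fun y hy => ?_⟩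
      · rw [hupd r hr]
        simp at hr
        simp [exec, Instr.apply, hr]
      · rw [harr a ha]
        simp [exec, Instr.apply, ha]
      · rcases Nat.lt_succ_iff_lt_or_eq.mp hy with hy | rfl
        · rw [hc y hy]
          simp [exec, Instr.apply, e1, e2, e3, e4, e5, e7]
        · rw [ho _ le_rfl]
          simp [exec, Instr.apply, h6, h2, e1, e3]
      · have : y ≠ c := by omega
        rw [ho y (by omega)]
        simp [exec, Instr.apply, h6, h2, this]

/-- Applies the filter to all intersections of array `2 + k` with `k` rows of array `0`. -/
def enumProg : ℕ → Prog
  | 0 => filterProg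
  | k + 1 => .seq (block [.add (20 + 2 * k) 0 2, .const (21 + 2 * k) 0])
      (.while (20 + 2 * k) (.seq (block [.sub (20 + 2 * k) (20 + 2 * k) 2, .add 6 0 8])
        (.seq (interLoop k) (.seq (block [.add (21 + 2 * k) (21 + 2 * k) 0]) (enumProg k)))))

/-- A bound for the running time of the enumeration. -/
def enumTime (n B : ℕ) : ℕ → ℕ
  | 0 => (7 * n + 13) * n + (9 * n + 8) * B + 5 * n + 12
  | k + 1 => 2 + ((n + 1) * (2 + (8 * n + 1 + (1 + enumTime n B k)) + 1) + 1)

/-- The intersections of `Z` with `k` rows. -/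
def intersections (n : ℕ) (N : ℕ → ℕ → Prop) : ℕ → Set ℕ → Set (Set ℕ)
  | 0, Z => {Z}
  | k + 1, Z => {K | ∃ j ≤ n, K ∈ intersections n N k (Z ∩ {x | N j x})}

lemma inter_mem_intersections (n : ℕ) (N : ℕ → ℕ → Prop) (l : List ℕ) (hl : ∀ j ∈ l, j ≤ n)
    (Z : Set ℕ) : Z ∩ {x | ∀ j ∈ l, N j x} ∈ intersections n N l.length Z := by
  induction l generalizing Z with
  | nil => simp [intersections]
  | cons i l ih =>
    refine ⟨i, hl i (by simp), ?_⟩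
    have := ih (fun j hj => hl j (by simp [hj])) (Z ∩ {x | N i x})
    convert this using 1
    ext x
    simp [and_assoc]

/-- Nested loops, one per row of the tuple. Each depth has its own two registers and array, and
`Frame` ensures that the inner loops do not disturb those of the outer ones. -/
lemma does_enumProg {n B : ℕ} {N : ℕ → ℕ → Prop} (hB : (closedSets n N).ncard ≤ B) (k : ℕ)
    {σ : State} {Z : Set ℕ} {F : Set (Set ℕ)} (hσ : Ready n N σ) (hZ : Z ⊆ Set.Iio n)
    (hrow : IsRow n (2 + k) Z σ) (hF : Listed n F σ) (hFc : F ⊆ closedSets n N) :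
    Does (enumProg k) σ (enumTime n B k) (fun τ =>
      Frame k σ τ ∧ Listed n (F ∪ {K | K ∈ intersections n N k Z ∧ K ∈ closedSets n N}) τ) := by
  induction k generalizing σ Z F with
  | zero =>
    refine (does_filter hσ hZ hrow hF).mono ?_ (fun τ hτ => hτ)
    have := Nat.mul_le_mul_left (9 * n + 8) (hF.reg_le hFc hB)
    simp only [enumTime]
    omega
  | succ k ih =>
    -- Loop invariant: `c` rows remain, namely those from `n + 1 - c` to `n`, and register `21 + 2 *
    -- k` holds the start of the first of them.
    have key : ∀ (c : ℕ) (σ : State) (F : Set (Set ℕ)), c ≤ n + 1 → Ready n N σ →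
        IsRow n (3 + k) Z σ → Listed n F σ → F ⊆ closedSets n N →
        σ.reg (20 + 2 * k) = c → σ.reg (21 + 2 * k) = (n + 1 - c) * n →
        Does (.while (20 + 2 * k) (.seq (block [.sub (20 + 2 * k) (20 + 2 * k) 2, .add 6 0 8])
          (.seq (interLoop k) (.seq (block [.add (21 + 2 * k) (21 + 2 * k) 0]) (enumProg k))))) σ
          (c * (2 + (8 * n + 1 + (1 + enumTime n B k)) + 1) + 1)
          (fun τ => Frame (k + 1) σ τ ∧ Listed n (F ∪ {K | (∃ j, n + 1 - c ≤ j ∧ j ≤ n ∧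
            K ∈ intersections n N k (Z ∩ {x | N j x})) ∧ K ∈ closedSets n N}) τ) := by
      clear! σ F
      intro c
      induction c with
      | zero =>
        intro σ F _ hσ hrow hF hFc hc hp
        refine does_while_of_eq_zero hc (by omega) ⟨⟨fun _ _ => rfl, fun _ _ => rfl⟩, ?_⟩
        convert hF using 1
        refine Set.union_eq_left.mpr ?_
        rintro K ⟨⟨j, h1, h2, -⟩, -⟩
        omega
      | succ c ihc =>
        intro σ F hcn hσ hrow hF hFc hc hp
        obtain ⟨i, hi⟩ : ∃ i, n + 1 - (c + 1) = i := ⟨_, rfl⟩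
        rw [hi] at hp
        have hin : i ≤ n := by omega
        have e1 : (2 : ℕ) ≠ 20 + 2 * k := by omega
        have e2 : (0 : ℕ) ≠ 20 + 2 * k := by omega
        have e3 : (8 : ℕ) ≠ 20 + 2 * k := by omega
        have e4 : 20 + 2 * k ≠ 6 := by omega
        have e5 : 21 + 2 * k ≠ 6 := by omega
        have e6 : 21 + 2 * k ≠ 20 + 2 * k := by omega
        set σ₁ := exec [.sub (20 + 2 * k) (20 + 2 * k) 2, .add 6 0 8] σ with hσ₁
        have a1 : σ₁.arr = σ.arr := rfl
        have r1 : ∀ r, r ≠ 20 + 2 * k → r ≠ 6 → σ₁.reg r = σ.reg r := fun r h h' => by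
          simp [hσ₁, exec, Instr.apply, h, h']
        have r1c : σ₁.reg (20 + 2 * k) = c := by
          simp [hσ₁, exec, Instr.apply, e4, hc, hσ.one]
        have body : Does (.seq (block [.sub (20 + 2 * k) (20 + 2 * k) 2, .add 6 0 8])
            (.seq (interLoop k) (.seq (block [.add (21 + 2 * k) (21 + 2 * k) 0]) (enumProg k)))) σ
            (2 + (8 * n + 1 + (1 + enumTime n B k))) (fun υ => Frame (k + 1) σ υ ∧
              υ.reg (20 + 2 * k) = c ∧ υ.reg (21 + 2 * k) = (i + 1) * n ∧
              Listed n (F ∪ {K | K ∈ intersections n N k (Z ∩ {x | N i x}) ∧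
                K ∈ closedSets n N}) υ) := by
          refine Does.block_seq ((does_interLoop k n σ₁ ?_ ?_).seq fun τ hτ => ?_)
          · simp [hσ₁, exec, Instr.apply, hσ.size, hσ.zero, e2, e3]
          · rw [r1 2 e1 (by decide), hσ.one]
          obtain ⟨hupd, harr, hand, -⟩ := hτ
          set τ₁ := exec [.add (21 + 2 * k) (21 + 2 * k) 0] τ with hτ₁
          have a2 : τ₁.arr = τ.arr := rfl
          have r2 : ∀ r, r ≠ 21 + 2 * k → τ₁.reg r = τ.reg r := fun r h => by
            simp [hτ₁, exec, Instr.apply, h]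
          have rr : ∀ r, r ≠ 20 + 2 * k → r ≠ 21 + 2 * k → r ∉ [6, 7, 9, 10, 11] →
              τ₁.reg r = σ.reg r := fun r h h' h'' => by
            rw [r2 r h', hupd r h'', r1 r h (fun h6 => h'' (by simp [h6]))]
          have hfr : Frame (k + 1) σ τ₁ := by
            refine ⟨fun r hr => rr r (by omega) (by omega) (by simp; omega), fun a ha => ?_⟩
            rw [a2, harr a (by omega), a1]
          refine Does.block_seq ((ih (Z := Z ∩ {x | N i x}) (F := F) (hσ.of_frame hfr)
            (fun x hx => hZ hx.1) ?_ (hF.congr (rr 1 (by omega) (by omega) (by simp)) ?_)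
            hFc).mono le_rfl ?_)
          · intro x hx
            rw [a2, hand x hx, a1, r1 _ e6 e5, hp, hrow x hx, hσ.matrix i hin x hx]
            by_cases h1 : x ∈ Z <;> by_cases h2 : N i x <;> simp [ind, h1, h2]
          · rw [a2, harr 1 (by omega), a1]
          · rintro υ ⟨hf, hL⟩
            refine ⟨hfr.trans hf (Nat.le_succ k), ?_, ?_, hL⟩
            · rw [hf.1 _ (by omega), r2 _ e6.symm, hupd _ (by simp; omega), r1c]
            · have h0 : τ.reg 0 = n := by
                rw [hupd 0 (by simp), r1 0 e2 (by decide), hσ.size]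
              have h21 : τ.reg (21 + 2 * k) = i * n := by
                rw [hupd _ (by simp; omega), r1 _ e6 e5, hp]
              rw [hf.1 _ (by omega), Nat.succ_mul i]
              simp [hτ₁, exec, Instr.apply, h0, h21]
        refine (Does.while_step (T' := c * (2 + (8 * n + 1 + (1 + enumTime n B k)) + 1) + 1)
          (by omega) body fun υ hυ => ?_).mono ?_ (fun _ h => h)
        · obtain ⟨hf, hc', hp', hL⟩ := hυ
          refine (ihc υ _ (by omega) (hσ.of_frame hf) ?_ hL ?_ hc' ?_).mono le_rfl ?_
          · intro x hx
            rw [hf.2 _ (by omega)]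
            exact hrow x hx
          · exact Set.union_subset hFc fun K hK => hK.2
          · rw [hp']
            congr 1
            omega
          · rintro ω ⟨hf', hL'⟩
            refine ⟨hf.trans hf' le_rfl, ?_⟩
            convert hL' using 1
            rw [Set.union_assoc]
            congr 1
            ext K
            simp only [Set.mem_ofPred_eq, Set.mem_union]
            constructor
            · rintro ⟨⟨j, hj, hjn, hK⟩, hKc⟩
              rcases Nat.eq_or_lt_of_le hj with h | h
              · left
                rw [← hi, h]
                exact ⟨hK, hKc⟩
              · exact Or.inr ⟨⟨j, by omega, hjn, hK⟩, hKc⟩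
            · rintro (⟨hK, hKc⟩ | ⟨⟨j, hj, hjn, hK⟩, hKc⟩)
              · exact ⟨⟨i, by omega, hin, hK⟩, hKc⟩
              · exact ⟨⟨j, by omega, hjn, hK⟩, hKc⟩
        · rw [Nat.succ_mul c]
          omega
    have e1 : (0 : ℕ) ≠ 20 + 2 * k := by omega
    have e2 : 20 + 2 * k ≠ 21 + 2 * k := by omega
    set σ₁ := exec [.add (20 + 2 * k) 0 2, .const (21 + 2 * k) 0] σ with hσ₁
    have hf : Frame (k + 1) σ σ₁ := by
      refine ⟨fun r hr => ?_, fun _ _ => rfl⟩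
      have h1 : r ≠ 20 + 2 * k := by omega
      have h2 : r ≠ 21 + 2 * k := by omega
      simp [hσ₁, exec, Instr.apply, h1, h2]
    have h1 : σ₁.reg 1 = σ.reg 1 := by
      have h1 : 1 ≠ 20 + 2 * k := by omega
      have h2 : 1 ≠ 21 + 2 * k := by omega
      simp [hσ₁, exec, Instr.apply, h1, h2]
    refine (Does.block_seq (key (n + 1) σ₁ F le_rfl (hσ.of_frame hf) ?_ (hF.congr h1 rfl) hFc
      ?_ ?_)).mono le_rfl ?_
    · intro x hx
      have : 2 + (k + 1) = 3 + k := by omega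
      rw [this] at hrow
      exact hrow x hx
    · simp [hσ₁, exec, Instr.apply, hσ.size, hσ.one]
    · simp [hσ₁, exec, Instr.apply]
    · rintro τ ⟨hf', hL⟩
      refine ⟨hf.trans hf' le_rfl, ?_⟩
      convert hL using 3
      ext K
      simp [intersections]

end Ram

namespace Ram

/-! ### Initialization -/

/-- Sets every `reg 3`-th cell of array `0` to one, starting from register `5`. -/
def diagonalLoop : Prog := .while 4 (block [.sub 4 4 2, .store 0 5 2, .add 5 5 3])

lemma does_diagonalLoop (c : ℕ) (σ : State) (h4 : σ.reg 4 = c) (h2 : σ.reg 2 = 1) :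
    Does diagonalLoop σ (4 * c + 1) (fun τ => Upd [4, 5] σ τ ∧
      τ.reg 5 = σ.reg 5 + c * σ.reg 3 ∧ (∀ a, a ≠ 0 → τ.arr a = σ.arr a) ∧
      (∀ j < c, τ.arr 0 (σ.reg 5 + j * σ.reg 3) = 1) ∧
      ∀ x, (∀ j < c, x ≠ σ.reg 5 + j * σ.reg 3) → τ.arr 0 x = σ.arr 0 x) := by
  induction c generalizing σ with
  | zero =>
    exact does_while_of_eq_zero h4 (by omega)
      ⟨Upd.refl _ _, by simp, fun _ _ => rfl, by simp, fun _ _ => rfl⟩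
  | succ c ih =>
    refine (Does.while_block_step (by omega) (ih _ ?_ ?_)).mono (by simp; omega) ?_
    · simp [exec, Instr.apply, h4, h2]
    · simp [exec, Instr.apply, h2]
    · rintro τ ⟨hupd, h5, harr, hc, ho⟩
      have e3 : (exec [.sub 4 4 2, .store 0 5 2, .add 5 5 3] σ).reg 3 = σ.reg 3 := by
        simp [exec, Instr.apply]
      have e5 : (exec [.sub 4 4 2, .store 0 5 2, .add 5 5 3] σ).reg 5 = σ.reg 5 + σ.reg 3 := by
        simp [exec, Instr.apply]
      have e : ∀ j, σ.reg 5 + σ.reg 3 + j * σ.reg 3 = σ.reg 5 + (j + 1) * σ.reg 3 :=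
        fun j => by ring
      rw [e3, e5, e] at h5
      simp only [e3, e5, e] at hc ho
      have h0 : (exec [.sub 4 4 2, .store 0 5 2, .add 5 5 3] σ).arr 0 =
          Function.update (σ.arr 0) (σ.reg 5) 1 := by
        simp [exec, Instr.apply, h2]
      rw [h0] at ho
      refine ⟨fun r hr => ?_, h5, fun a ha => ?_, fun j hj => ?_, fun x hx => ?_⟩
      · rw [hupd r hr]
        simp at hr
        simp [exec, Instr.apply, hr]
      · rw [harr a ha]
        simp [exec, Instr.apply, ha]
      -- The stride may be zero here, so the cell written first may be written again; it receives a
      -- one in either case.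
      · by_cases h : ∃ i < c, σ.reg 5 + j * σ.reg 3 = σ.reg 5 + (i + 1) * σ.reg 3
        · obtain ⟨i, hi, h⟩ := h
          rw [h, hc i hi]
        · push Not at h
          rw [ho _ h]
          cases j with
          | zero => simp
          | succ j => exact absurd rfl (h j (by omega))
      · rw [ho x fun j hj => hx (j + 1) (by omega),
          Function.update_of_ne (by simpa using hx 0 (by omega))]

/-- Fills the segment of array `0` that ends at register `5` and the beginning of array `2 + q`
with ones. -/
def onesLoop (q : ℕ) : Prog :=
  .while 4 (block [.sub 4 4 2, .sub 5 5 2, .store 0 5 2, .store (2 + q) 4 2])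

lemma does_onesLoop (q b c : ℕ) (σ : State) (h4 : σ.reg 4 = c) (h5 : σ.reg 5 = b + c)
    (h2 : σ.reg 2 = 1) :
    Does (onesLoop q) σ (5 * c + 1) (fun τ => Upd [4, 5] σ τ ∧
      (∀ a, a ≠ 0 → a ≠ 2 + q → τ.arr a = σ.arr a) ∧
      (∀ x < c, τ.arr 0 (b + x) = 1 ∧ τ.arr (2 + q) x = 1) ∧
      (∀ x, b + c ≤ x → τ.arr 0 x = σ.arr 0 x) ∧ (∀ x < b, τ.arr 0 x = σ.arr 0 x) ∧
      ∀ x, c ≤ x → τ.arr (2 + q) x = σ.arr (2 + q) x) := by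
  induction c generalizing σ with
  | zero =>
    exact does_while_of_eq_zero h4 (by omega)
      ⟨Upd.refl _ _, fun _ _ _ => rfl, by simp, fun _ _ => rfl, fun _ _ => rfl, fun _ _ => rfl⟩
  | succ c ih =>
    have hq : 0 ≠ 2 + q := by omega
    refine (Does.while_block_step (by omega) (ih _ ?_ ?_ ?_)).mono (by simp; omega) ?_
    · simp [exec, Instr.apply, h4, h2]
    · simp [exec, Instr.apply, h5, h2]
    · simp [exec, Instr.apply, h2]
    · rintro τ ⟨hupd, harr, hc, ho, ho', ho''⟩
      have hb : b + (c + 1) - 1 = b + c := by omega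
      have h0 : (exec [.sub 4 4 2, .sub 5 5 2, .store 0 5 2, .store (2 + q) 4 2] σ).arr 0 =
          Function.update (σ.arr 0) (b + c) 1 := by
        simp [exec, Instr.apply, h2, h5, hq]
      have hq' : (exec [.sub 4 4 2, .sub 5 5 2, .store 0 5 2, .store (2 + q) 4 2] σ).arr (2 + q) =
          Function.update (σ.arr (2 + q)) c 1 := by
        simp [exec, Instr.apply, h2, h4]
      rw [h0] at ho ho'
      rw [hq'] at ho''
      refine ⟨fun r hr => ?_, fun a ha ha' => ?_, fun x hx => ?_, fun x hx => ?_, fun x hx => ?_,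
        fun x hx => ?_⟩
      · rw [hupd r hr]
        simp at hr
        simp [exec, Instr.apply, hr]
      · rw [harr a ha ha']
        simp [exec, Instr.apply, ha, ha']
      · rcases Nat.lt_succ_iff_lt_or_eq.mp hx with hx | rfl
        · exact hc x hx
        · rw [ho _ le_rfl, ho'' _ le_rfl]
          simp
      · rw [ho x (by omega), Function.update_of_ne (by omega)]
      · rw [ho' x hx, Function.update_of_ne (by omega)]
      · rw [ho'' x (by omega), Function.update_of_ne (by omega)]

/-- Puts the constants in place, makes the matrix reflexive, adds a row of ones and writes the set
of all vertices to array `2 + q`. -/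
def initProg (q : ℕ) : Prog :=
  .seq (block [.const 2 1, .add 3 0 2, .add 4 0 8]) (.seq diagonalLoop
    (.seq (block [.add 4 0 8]) (onesLoop q)))

/-- The reflexive adjacency matrix of `G` with an additional row of ones. -/
def closedAdj (G : FinGraph.{u}) (e : Fin G.order ≃ G.V) (i x : ℕ) : Prop :=
  i = G.order ∨ ∃ (hi : i < G.order) (hx : x < G.order),
    e ⟨x, hx⟩ ∈ G.closedNeighborhood (e ⟨i, hi⟩)

lemma mul_add_inj {n i j x y : ℕ} (hx : x < n) (hy : y < n) (h : i * n + x = j * n + y) :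
    i = j ∧ x = y := by
  have hn : 0 < n := by omega
  have h1 := congrArg (· / n) h
  have h2 := congrArg (· % n) h
  simp only [mul_comm _ n, Nat.mul_add_div hn, Nat.div_eq_of_lt hx, Nat.div_eq_of_lt hy,
    Nat.mul_add_mod, Nat.mod_eq_of_lt hx, Nat.mod_eq_of_lt hy] at h1 h2
  exact ⟨h1, h2⟩

lemma does_initProg (q : ℕ) (G : FinGraph.{u}) (e : Fin G.order ≃ G.V) :
    Does (initProg q) (inputState G e) (9 * G.order + 6) (fun τ =>
      Ready G.order (closedAdj G e) τ ∧ IsRow G.order (2 + q) (Set.Iio G.order) τ ∧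
        Listed G.order ∅ τ) := by
  set σ := inputState G e with hσ
  have s0 : σ.reg 0 = G.order := by simp [hσ, inputState]
  have s1 : σ.reg 1 = 0 := by simp [hσ, inputState]
  have s5 : σ.reg 5 = 0 := by simp [hσ, inputState]
  have s8 : σ.reg 8 = 0 := by simp [hσ, inputState]
  -- With stride `n + 1` from cell zero, `n` steps mark the diagonal and stop at `n * n + n`, the
  -- end of the additional row, which is then filled downwards.
  refine (Does.block_seq ((does_diagonalLoop G.order _ ?_ ?_).seq fun τ hτ => Does.block_seq
    ((does_onesLoop q (G.order * G.order) G.order _ ?_ ?_ ?_).mono le_rfl ?_))).mono (by simp; omega) (fun _ h => h)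
  · simp [exec, Instr.apply, s0, s8]
  · simp [exec, Instr.apply]
  all_goals
    obtain ⟨hupd, h5, harr, hd, ho⟩ := hτ
    have hu : Upd [2, 3, 4, 5] σ τ := by
      refine Upd.trans (S := [2, 3, 4]) (fun r hr => ?_) hupd (by decide) (by decide)
      simp at hr
      simp [exec, Instr.apply, hr]
    have t2 : τ.reg 2 = 1 := by
      rw [hupd 2 (by decide)]
      simp [exec, Instr.apply]
    simp [exec, Instr.apply, s0, s5] at h5 hd ho
  · simp [exec, Instr.apply, hu 0 (by decide), hu 8 (by decide), s0, s8]
  · simp [exec, Instr.apply, h5]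
    ring
  · simp [exec, Instr.apply, t2]
  · rintro υ ⟨hupd', harr', hone, -, hold, -⟩
    have hu' : Upd [2, 3, 4, 5] σ υ := by
      refine hu.trans (Upd.trans (S := [4]) (U := [4, 5]) (fun r hr => ?_) hupd'
        (by decide) (by decide)) (by decide) (by decide)
      simp at hr
      simp [exec, Instr.apply, hr]
    refine ⟨⟨(hu' 0 (by decide)).trans s0, ?_, (hu' 8 (by decide)).trans s8,
      fun i hi x hx => ?_⟩, fun x hx => ?_, ?_⟩
    · rw [hupd' 2 (by decide)]
      simp [exec, Instr.apply, t2]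
    · rcases Nat.eq_or_lt_of_le hi with rfl | hi
      · rw [(hone x hx).1, ind_of (show closedAdj G e _ x from Or.inl rfl)]
      · have hlt : i * G.order + x < G.order * G.order := by
          have := Nat.mul_le_mul_right G.order (Nat.succ_le_of_lt hi)
          rw [Nat.succ_mul] at this
          omega
        rw [hold _ hlt]
        simp only [exec, Instr.apply]
        by_cases hix : i = x
        · subst hix
          have : i * G.order + i = i * (G.order + 1) := by ring
          rw [this, hd i hi, ind_of]
          exact Or.inr ⟨hi, hx, Or.inl rfl⟩
        · rw [ho _ fun j hj h => hix ?_]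
          · have hiff : (∃ i' j' : Fin G.order, i * G.order + x = i' * G.order + j' ∧
                G.graph.Adj (e i') (e j')) ↔ closedAdj G e i x := by
              constructor
              · rintro ⟨i', j', h, hadj⟩
                obtain ⟨rfl, rfl⟩ := mul_add_inj hx j'.2 h
                exact Or.inr ⟨hi, hx, Or.inr hadj⟩
              · rintro (h | ⟨_, _, h | h⟩)
                · exact absurd h hi.ne
                · have := e.injective h
                  simp only [Fin.mk.injEq] at this
                  exact absurd this.symm hix
                · exact ⟨⟨i, hi⟩, ⟨x, hx⟩, rfl, h⟩
            by_cases h : closedAdj G e i x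
            · rw [ind_of h]
              exact if_pos ⟨rfl, hiff.mpr h⟩
            · rw [ind_of_not h]
              exact if_neg fun h' => h (hiff.mp h'.2)
          · have h : i * G.order + x = j * G.order + j := h.trans (by ring)
            obtain ⟨rfl, rfl⟩ := mul_add_inj hx hj h
            rfl
    · rw [(hone x hx).2, ind_of]
      exact hx
    · have h1 : υ.reg 1 = 0 := (hu' 1 (by decide)).trans s1
      refine ⟨by simp [h1], ?_⟩
      rw [h1]
      simp [Set.Iio]

/-! ### Correctness of the program -/

/-- The set of vertices whose numbers are in `S`. -/
def vertexSet (G : FinGraph.{u}) (e : Fin G.order ≃ G.V) (S : Set ℕ) : Set G.V :=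
  {v | (e.symm v : ℕ) ∈ S}

lemma outputSet_eq (G : FinGraph.{u}) (e : Fin G.order ≃ G.V) (σ : State) (i : ℕ) :
    outputSet G e σ i = vertexSet G e (rowSet G.order σ i) := by
  ext v
  simp [outputSet, vertexSet, rowSet]

lemma mem_vertexSet {G : FinGraph.{u}} {e : Fin G.order ≃ G.V} {S : Set ℕ} {x : ℕ}
    (hx : x < G.order) : e ⟨x, hx⟩ ∈ vertexSet G e S ↔ x ∈ S := by
  simp [vertexSet]

/-- Under the numbering, the condition defining `closedSets` is the fixed-point equation of
`mem_maximalCliques_iff`. -/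
lemma bijOn_vertexSet (G : FinGraph.{u}) (e : Fin G.order ≃ G.V) :
    Set.BijOn (vertexSet G e) (closedSets G.order (closedAdj G e)) G.maximalCliques := by
  have hiff : ∀ K ⊆ Set.Iio G.order, vertexSet G e K ∈ G.maximalCliques ↔
      K ∈ closedSets G.order (closedAdj G e) := by
    intro K hK
    rw [FinGraph.mem_maximalCliques_iff]
    simp only [closedSets, Set.mem_ofPred_eq, hK, true_and, Set.ext_iff, Set.mem_iInter]
    rw [← e.forall_congr_right, Fin.forall_iff]
    refine forall₂_congr fun j hj => ?_
    rw [mem_vertexSet]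
    refine iff_congr Iff.rfl ?_
    rw [← e.forall_congr_right, Fin.forall_iff]
    refine forall₂_congr fun y hy => ?_
    rw [mem_vertexSet, FinGraph.mem_closedNeighborhood_comm]
    refine forall_congr' fun _ => ?_
    constructor
    · exact fun h => Or.inr ⟨hj, hy, h⟩
    · rintro (h | ⟨_, _, h⟩)
      · exact absurd h hj.ne
      · exact h
  refine ⟨fun K hK => (hiff K hK.1).mpr hK, fun K hK L hL h => ?_, fun K hK => ?_⟩
  · ext x
    by_cases hx : x < G.order
    · rw [← mem_vertexSet (e := e) hx, h, mem_vertexSet hx]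
    · exact ⟨fun h => absurd (hK.1 h) hx, fun h => absurd (hL.1 h) hx⟩
  · have h : vertexSet G e {x | ∃ hx : x < G.order, e ⟨x, hx⟩ ∈ K} = K := by
      ext v
      simp [vertexSet]
    refine ⟨{x | ∃ hx : x < G.order, e ⟨x, hx⟩ ∈ K}, ?_, h⟩
    rw [← hiff _ (fun x hx => hx.1), h]
    exact hK

lemma closedSets_subset_intersections {G : FinGraph.{u}} {q : ℕ}
    (hG : ∀ K ∈ G.maximalCliques, ∃ A : Finset G.V, A.card ≤ q ∧ (A : Set G.V) ⊆ K ∧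
      K = ⋂ a ∈ A, G.closedNeighborhood a) (e : Fin G.order ≃ G.V) :
    closedSets G.order (closedAdj G e) ⊆
      intersections G.order (closedAdj G e) q (Set.Iio G.order) := by
  intro K hK
  obtain ⟨A, hAq, -, hA⟩ := hG _ ((bijOn_vertexSet G e).mapsTo hK)
  have := inter_mem_intersections G.order (closedAdj G e)
    -- The row of ones, with index `n`, pads a generating set of at most `q` vertices to exactly `q`
    -- rows without changing the intersection.
    (A.toList.map (fun a => (e.symm a : ℕ)) ++ List.replicate (q - A.card) G.order) (by
      intro j hj
      rw [List.mem_append, List.mem_map] at hj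
      rcases hj with ⟨a, -, rfl⟩ | hj
      · exact (e.symm a).2.le
      · exact (List.eq_of_mem_replicate hj).le) (Set.Iio G.order)
  rw [List.length_append, List.length_map, Finset.length_toList, List.length_replicate,
    Nat.add_sub_cancel' hAq] at this
  convert this using 1
  ext x
  by_cases hx : x < G.order
  · rw [← mem_vertexSet (e := e) hx, hA]
    simp only [Set.mem_iInter, Set.mem_inter_iff, Set.mem_Iio, hx, true_and, Set.mem_ofPred_eq,
      List.mem_append, List.mem_map, Finset.mem_toList]
    constructor
    · rintro h j (⟨a, ha, rfl⟩ | hj)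
      · exact Or.inr ⟨(e.symm a).2, hx, by simpa using h a ha⟩
      · exact Or.inl (List.eq_of_mem_replicate hj)
    · intro h a ha
      rcases h _ (Or.inl ⟨a, ha, rfl⟩) with h | ⟨_, _, h⟩
      · exact absurd h (e.symm a).2.ne
      · simpa using h
  · exact ⟨fun h => absurd (hK.1 h) hx, fun h => absurd h.1 hx⟩

/-- The program that lists the maximal cliques generated by at most `q` of their members. -/
def cliqueProg (q : ℕ) : Prog := .seq (initProg q) (enumProg q)

lemma does_cliqueProg {G : FinGraph.{u}} {q B : ℕ}
    (hG : ∀ K ∈ G.maximalCliques, ∃ A : Finset G.V, A.card ≤ q ∧ (A : Set G.V) ⊆ K ∧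
      K = ⋂ a ∈ A, G.closedNeighborhood a) (hB : G.maximalCliques.ncard ≤ B)
    (e : Fin G.order ≃ G.V) :
    Does (cliqueProg q) (inputState G e) (9 * G.order + 6 + enumTime G.order B q)
      (fun σ => Lists G e σ G.maximalCliques) := by
  have hbij := bijOn_vertexSet G e
  have hB' : (closedSets G.order (closedAdj G e)).ncard ≤ B := by
    rw [← hbij.injOn.ncard_image, hbij.image_eq]
    exact hB
  refine (does_initProg q G e).seq fun τ ⟨hτ, hrow, hL⟩ =>
    (does_enumProg hB' q hτ subset_rfl hrow hL (Set.empty_subset _)).mono le_rfl ?_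
  rintro σ ⟨-, -, hσ⟩
  have hF : ∅ ∪ {K | K ∈ intersections G.order (closedAdj G e) q (Set.Iio G.order) ∧
      K ∈ closedSets G.order (closedAdj G e)} = closedSets G.order (closedAdj G e) := by
    ext K
    simp only [Set.empty_union, Set.mem_ofPred_eq, and_iff_right_iff_imp]
    exact fun hK => closedSets_subset_intersections hG e hK
  rw [hF] at hσ
  exact (hbij.comp hσ).congr fun i _ => (outputSet_eq G e σ i).symm

open Polynomial in
/-- The running time of the enumeration is polynomial. -/
lemma exists_polynomial_enumTime (q k : ℕ) :
    ∃ p : Polynomial ℕ, ∀ n, enumTime n (n ^ q + 1) k = p.eval n := by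
  induction k with
  | zero =>
    refine ⟨(7 * X + 13) * X + (9 * X + 8) * (X ^ q + 1) + 5 * X + 12, fun n => ?_⟩
    simp [enumTime]
  | succ k ih =>
    obtain ⟨p, hp⟩ := ih
    refine ⟨2 + ((X + 1) * (2 + (8 * X + 1 + (1 + p)) + 1) + 1), fun n => ?_⟩
    simp [enumTime, hp]

end Ram

theorem mainTheorem8 (C : Set FinGraph.{u}) (hC : FinGraph.NowhereDense C) (d : ℕ) :
    ∃ q : ℕ,
      (∀ H ∈ FinGraph.hereditaryClosure (FinGraph.powerClass C d),
        (1 ≤ H.order → H.maximalCliques.ncard ≤ H.order ^ q) ∧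
        ∀ K ∈ H.maximalCliques, ∃ A : Finset H.V,
          A.card ≤ q ∧ (A : Set H.V) ⊆ K ∧ K = ⋂ a ∈ A, H.closedNeighborhood a) ∧
      ∃ (P : Ram.Prog) (p : Polynomial ℕ),
        ∀ H ∈ FinGraph.hereditaryClosure (FinGraph.powerClass C d),
        ∀ e : Fin H.order ≃ H.V,
          ∃ (t : ℕ) (σ : Ram.State), Ram.Runs P (Ram.inputState H e) t σ ∧
            t ≤ p.eval H.order ∧ Ram.Lists H e σ H.maximalCliques := by
  obtain ⟨q₀, hq₀⟩ := hC.exists_small_generating_set d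
  -- Passing to `q₀ + 1` makes the exponent positive, as the count of maximal cliques requires.
  have hgen : ∀ H ∈ FinGraph.hereditaryClosure (FinGraph.powerClass C d),
      ∀ K ∈ H.maximalCliques, ∃ A : Finset H.V,
        A.card ≤ q₀ + 1 ∧ (A : Set H.V) ⊆ K ∧ K = ⋂ a ∈ A, H.closedNeighborhood a := by
    intro H hH K hK
    obtain ⟨A, hA, h⟩ := hq₀ H hH K hK
    exact ⟨A, by omega, h⟩
  have hcount : ∀ H ∈ FinGraph.hereditaryClosure (FinGraph.powerClass C d),
      1 ≤ H.order → H.maximalCliques.ncard ≤ H.order ^ (q₀ + 1) := fun H hH h =>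
    FinGraph.ncard_maximalCliques_le (by omega) h (hgen H hH)
  obtain ⟨p, hp⟩ := Ram.exists_polynomial_enumTime (q₀ + 1) (q₀ + 1)
  refine ⟨q₀ + 1, fun H hH => ⟨hcount H hH, hgen H hH⟩, Ram.cliqueProg (q₀ + 1), 9 * Polynomial.X + 6 + p,
    fun H hH e => ?_⟩
  -- The summand one covers the graph without vertices, whose empty set is a maximal clique although
  -- the power is zero.
  have hB : H.maximalCliques.ncard ≤ H.order ^ (q₀ + 1) + 1 := by
    rcases Nat.eq_zero_or_pos H.order with h | h
    · have : IsEmpty H.V := by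
        rw [h] at e
        exact e.symm.isEmpty
      exact (Set.ncard_le_one_of_subsingleton _).trans (Nat.le_add_left _ _)
    · exact (hcount H hH h).trans (Nat.le_succ _)
  obtain ⟨t, σ, hr, ht, hL⟩ := Ram.does_cliqueProg (hgen H hH) hB e
  refine ⟨t, σ, hr, ht.trans ?_, hL⟩
  rw [hp]
  simp
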